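/- Let $d\ge 0$ be an integer, let $\mathcal P$ be a countable index set, and for each $p\in\mathcal P$ let $C_p$ be an invertible real $d\times d$ matrix, $C_p^*$ its transpose and $C_p'=(C_p^*)^{-1}$. Let $\hat f$ denote the Fourier transform on $L^2(\mathbb R^d)$ with $\hat f(\xi)=\int f(x)e^{-2\pi i x\cdot\xi}\,dx$ for $f\in L^1\cap L^2$, and for $\beta\in\mathbb R^d$ let $T_\beta f(x)=f(x-\beta)$. Put $$\Lambda=\bigcup_{p\in\mathcal P}C_p'\mathbb Z^d,\qquad \mathcal P_\alpha=\{p\in\mathcal P: C_p^*\alpha\in\mathbb Z^d\}\quad(\alpha\in\Lambda).$$ Let $\{g_p\}_{p\in\mathcal P},\{h_p\}_{p\in\mathcal P}\subset L^2(\mathbb R^d)$ be such that each of the systems $\{T_{C_pk}g_p\}_{p\in\mathcal P,k\in\mathbb Z^d}$ and $\{T_{C_pk}h_p\}_{p\in\mathcal P,k\in\mathbb Z^d}$ satisfies: * the Bessel condition: there is $M<\infty$ with $\sum_{p\in\mathcal P}\sum_{k\in\mathbb Z^d}|\langle f,T_{C_pk}g_p\rangle|^2\le M\|f\|^2$ for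 all $f\in L^2(\mathbb R^d)$ (respectively with $h_p$ in place of $g_p$); * the local integrability condition: for every $f\in L^2(\mathbb R^d)$ such that $\hat f\in L^\infty(\mathbb R^d)$ and $\operatorname{supp}\hat f$ is compact and bounded away from $0$, $$\sum_{p\in\mathcal P}\sum_{k\in\mathbb Z^d}\int_{\operatorname{supp}\hat f}|\hat f(\xi+C_p'k)|^2\,|\det C_p|^{-1}|\hat g_p(\xi)|^2\,d\xi<\infty$$ (respectively with $\hat h_p$ in place of $\hat g_p$). Let $\Theta$ be the bounded operator on $L^2(\mathbb R^d)$ given by $$\Theta f=\sum_{p\in\mathcal P}\sum_{k\in\mathbb Z^d}\langle f,T_{C_pk}h_p\rangle\,T_{C_pk}g_p .$$ Then the series $$s(\xi)=\sum_{p\in\mathcal P}|\det C_p|^{-1}\overline{\hat h_p(\xi)}\,\hat g_p(\xi)\qquad\text{and}\qquad \sum_{p\in\mathcal P_\alpha}|\det C_p|^{-1}\overline{\hat h_p(\xi)}\,\hat g_p(\xi+\alpha)\quad(\alpha\in\Lambda)$$ converge absolutely for a.e. $\xi$, and the following hold. 1. $\Theta=0$ if and only if $\Theta$ commutes with $T_\beta$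 for every $\beta\in\mathbb R^d$ and $s(\xi)=0$ for a.e. $\xi$. 2. $\Theta=0$ if and only if $s(\xi)=0$ for a.e. $\xi$ and, for every $\alpha\in\Lambda\setminus\{0\}$, $$\sum_{p\in\mathcal P_\alpha}|\det C_p|^{-1}\overline{\hat h_p(\xi)}\,\hat g_p(\xi+\alpha)=0\quad\text{for a.e. }\xi .$$ -/

import Mathlib

open MeasureTheory Topology Matrix
open scoped FourierTransform ENNReal

/-! ### Bessel families, analysis operators and mixed dual Gramians in a Hilbert space -/

section Bessel

variable {ι H : Type*} [NormedAddCommGroup H] [InnerProductSpace ℂ H]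

/-- A family `x` in a Hilbert space satisfies the Bessel condition if
`∑ j, |⟨v, x j⟩|² ≤ M ‖v‖²` for all `v` and some finite constant `M`. -/
def IsBessel (x : ι → H) : Prop :=
  ∃ M : ℝ, ∀ v : H, Summable (fun j => ‖inner ℂ (x j) v‖ ^ 2) ∧
    ∑' j, ‖inner ℂ (x j) v‖ ^ 2 ≤ M * ‖v‖ ^ 2

/-- The coefficient sequence `(⟨v, x j⟩)_j` of a Bessel family, as an element of `ℓ²`. Mathlib's
inner product is linear in the second variable, so `⟨v, x j⟩` is `inner ℂ (x j) v`. -/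
noncomputable def IsBessel.coeff {x : ι → H} (hx : IsBessel x) (v : H) : lp (fun _ : ι => ℂ) 2 :=
  ⟨fun j => inner ℂ (x j) v, memℓp_gen (by
    obtain ⟨M, hM⟩ := hx
    simpa using (hM v).1)⟩

/-- The analysis operator `θ_x : v ↦ (⟨v, x j⟩)_j`, from `H` to `ℓ²`, of a Bessel family `x`. -/
noncomputable def IsBessel.analysis {x : ι → H} (hx : IsBessel x) :
    H →L[ℂ] lp (fun _ : ι => ℂ) 2 :=
  LinearMap.mkContinuousOfExistsBound
    { toFun := hx.coeff
      map_add' := fun v w => by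
        ext j
        exact inner_add_right (x j) v w
      map_smul' := fun c v => by
        ext j
        exact inner_smul_right (x j) v c }
    (by
      obtain ⟨M, hM⟩ := id hx
      refine ⟨Real.sqrt |M|, fun v => ?_⟩
      have h1 : ‖hx.coeff v‖ ^ 2 = ∑' j, ‖inner ℂ (x j) v‖ ^ 2 := by
        have h := lp.norm_rpow_eq_tsum (p := 2) (by norm_num) (hx.coeff v)
        simpa [IsBessel.coeff] using h
      have h2 : ‖hx.coeff v‖ ^ 2 ≤ (Real.sqrt |M| * ‖v‖) ^ 2 := by
        rw [h1, mul_pow, Real.sq_sqrt (abs_nonneg M)]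
        exact (hM v).2.trans (mul_le_mul_of_nonneg_right (le_abs_self M) (sq_nonneg _))
      exact abs_le_of_sq_le_sq' h2 (by positivity) |>.2)

@[simp]
theorem IsBessel.analysis_apply {x : ι → H} (hx : IsBessel x) (v : H) (j : ι) :
    hx.analysis v j = inner ℂ (x j) v := rfl

variable [CompleteSpace H]

/-- The mixed dual Gramian `θ_y^* θ_x` of two Bessel families `x` and `y`. -/
noncomputable def mixedGramian {x y : ι → H} (hx : IsBessel x) (hy : IsBessel y) : H →L[ℂ] H :=
  (ContinuousLinearMap.adjoint hy.analysis).comp hx.analysis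

/-- The mixed dual Gramian is the convergent sum `v ↦ ∑ j, ⟨v, x j⟩ y j`. -/
theorem hasSum_mixedGramian {x y : ι → H} (hx : IsBessel x) (hy : IsBessel y) (v : H) :
    HasSum (fun j => (inner ℂ (x j) v : ℂ) • y j) (mixedGramian hx hy v) := by
  classical
  have h := (lp.hasSum_single (E := fun _ : ι => ℂ) (p := 2) (by norm_num) (hx.analysis v)).map
    (ContinuousLinearMap.adjoint hy.analysis)
    (ContinuousLinearMap.adjoint hy.analysis).continuous
  change HasSum _ (ContinuousLinearMap.adjoint hy.analysis (hx.analysis v))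
  convert h using 1
  funext j
  refine ext_inner_right ℂ fun w => ?_
  simp only [Function.comp]
  rw [ContinuousLinearMap.adjoint_inner_left, lp.inner_single_left, inner_smul_left,
    IsBessel.analysis_apply, IsBessel.analysis_apply]
  simp [mul_comm]

end Bessel

/-! ### Translation systems in `L²(ℝᵈ)` -/

/-- `ℝᵈ` with its Euclidean structure. -/
abbrev Rd (d : ℕ) : Type := EuclideanSpace ℝ (Fin d)

/-- `L²(ℝᵈ)` with complex values and Lebesgue measure. -/
noncomputable abbrev L2Rd (d : ℕ) : Type := Lp (α := Rd d) ℂ 2 (volume : Measure (Rd d))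

/-- A representative of the Fourier transform `f̂` of `f ∈ L²(ℝᵈ)`, the continuous extension to
`L²(ℝᵈ)` of `f̂(ξ) = ∫ f(x) exp(-2πi x·ξ) dx`. -/
noncomputable def fhat {d : ℕ} (f : L2Rd d) : Rd d → ℂ :=
  ((𝓕 f : L2Rd d) : Rd d → ℂ)

/-- The translation operator `T_β : f ↦ f(· - β)` on `L²(ℝᵈ)`. -/
noncomputable def translation {d : ℕ} (β : Rd d) : L2Rd d →L[ℂ] L2Rd d :=
  (Lp.compMeasurePreservingₗᵢ ℂ (fun x : Rd d => x - β)
    (measurePreserving_sub_right volume β)).toContinuousLinearMap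

/-- The vector `C k ∈ ℝᵈ` for a real `d × d` matrix `C` and `k ∈ ℤᵈ`. -/
noncomputable def latticePoint {d : ℕ} (C : Matrix (Fin d) (Fin d) ℝ) (k : Fin d → ℤ) : Rd d :=
  WithLp.toLp 2 (C *ᵥ fun i => (k i : ℝ))

/-- `C' = (C^*)⁻¹`, the inverse of the transpose. -/
noncomputable def contragredient {d : ℕ} (C : Matrix (Fin d) (Fin d) ℝ) :
    Matrix (Fin d) (Fin d) ℝ :=
  (Cᵀ)⁻¹

/-- The system `{T_{C_p k} g_p}`, indexed by `(p, k) ∈ P × ℤᵈ`. -/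
noncomputable def translationSystem {d : ℕ} {P : Type*} (C : P → Matrix (Fin d) (Fin d) ℝ)
    (g : P → L2Rd d) : P × (Fin d → ℤ) → L2Rd d :=
  fun q => translation (latticePoint (C q.1) q.2) (g q.1)

/-- The (closed) essential support of a function on `ℝᵈ`. -/
def essSupport {d : ℕ} (F : Rd d → ℂ) : Set (Rd d) :=
  {ξ | ∀ U ∈ 𝓝 ξ, 0 < volume {η | η ∈ U ∧ F η ≠ 0}}

/-- The space `𝒟` of those `f ∈ L²(ℝᵈ)` for which `f̂` is essentially bounded and has compact
support that is bounded away from `0`. -/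
def testSpace (d : ℕ) : Set (L2Rd d) :=
  {f | MemLp (fhat f) ∞ volume ∧ IsCompact (essSupport (fhat f)) ∧
    ∃ r : ℝ, 0 < r ∧ ∀ ξ ∈ essSupport (fhat f), r ≤ ‖ξ‖}

/-- The local integrability condition for `{T_{C_p k} g_p}`: for all `f ∈ 𝒟`,
`∑_p ∑_k ∫_{supp f̂} |f̂(ξ + C_p' k)|² |det C_p|⁻¹ |ĝ_p(ξ)|² dξ < ∞`. -/
def LocallyIntegrableSystem {d : ℕ} {P : Type*} (C : P → Matrix (Fin d) (Fin d) ℝ)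
    (g : P → L2Rd d) : Prop :=
  ∀ f ∈ testSpace d,
    ∑' (p : P) (k : Fin d → ℤ), ∫⁻ ξ in essSupport (fhat f),
      ‖fhat f (ξ + latticePoint (contragredient (C p)) k)‖ₑ ^ 2 *
        ENNReal.ofReal (|(C p).det|⁻¹) * ‖fhat (g p) ξ‖ₑ ^ 2 < ∞

/-- `Λ = ⋃_p C_p' ℤᵈ`. -/
def dualLattices {d : ℕ} {P : Type*} (C : P → Matrix (Fin d) (Fin d) ℝ) : Set (Rd d) :=
  ⋃ p, Set.range (latticePoint (contragredient (C p)))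

/-- `P_α = {p : C_p^* α ∈ ℤᵈ}`. -/
def indexSet {d : ℕ} {P : Type*} (C : P → Matrix (Fin d) (Fin d) ℝ) (α : Rd d) : Set P :=
  {p | ∃ z : Fin d → ℤ, (C p)ᵀ *ᵥ (fun i => α i) = fun i => (z i : ℝ)}

/-- The term `|det C_p|⁻¹ conj(ĥ_p(ξ)) ĝ_p(ξ + α)`. -/
noncomputable def symbolTerm {d : ℕ} {P : Type*} (C : P → Matrix (Fin d) (Fin d) ℝ)
    (g h : P → L2Rd d) (α : Rd d) (p : P) (ξ : Rd d) : ℂ :=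
  ((|(C p).det|⁻¹ : ℝ) : ℂ) * (starRingEnd ℂ) (fhat (h p) ξ) * fhat (g p) (ξ + α)

/-- The symbol `s(ξ) = ∑_p |det C_p|⁻¹ conj(ĥ_p(ξ)) ĝ_p(ξ)`. -/
noncomputable def symbol {d : ℕ} {P : Type*} (C : P → Matrix (Fin d) (Fin d) ℝ)
    (g h : P → L2Rd d) (ξ : Rd d) : ℂ :=
  ∑' p : P, ((|(C p).det|⁻¹ : ℝ) : ℂ) * (starRingEnd ℂ) (fhat (h p) ξ) * fhat (g p) ξ

/-- `Θ = θ_g^* θ_h = ∑_p ∑_k ⟨·, T_{C_p k} h_p⟩ T_{C_p k} g_p`. -/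
noncomputable def Theta {d : ℕ} {P : Type*} {C : P → Matrix (Fin d) (Fin d) ℝ}
    {g h : P → L2Rd d} (hg : IsBessel (translationSystem C g))
    (hh : IsBessel (translationSystem C h)) : L2Rd d →L[ℂ] L2Rd d :=
  mixedGramian hh hg

/-- The commutant `{T_β : β ∈ ℝᵈ}'`. -/
def translationCommutant (d : ℕ) : Set (L2Rd d →L[ℂ] L2Rd d) :=
  Set.centralizer (Set.range (translation (d := d)))

/-!
Let `f` and `v` have bounded spectra contained in a bounded shell. For fixed `p`, Parseval's
identity on the torus, applied to the periodizations along `C_p' ℤᵈ` of the products `conj ĥ_p · f̂`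
and `conj ĝ_p · v̂`, turns `∑ k, ⟨f, T_{C_p k} h_p⟩ ⟨T_{C_p k} g_p, v⟩` into a sum over `C_p' ℤᵈ`.
Replacing `f` and `v` by `T_x f` and `T_x v` multiplies the term at the frequency `α` by
`exp(2πi x·α)`. Local integrability makes the sum over all `p` absolutely convergent, so
`x ↦ ⟨Θ T_x f, T_x v⟩` is an almost periodic function with frequencies in `Λ`, whose coefficient
at `α` is the integral of `∑_{p ∈ P_α} |det C_p|⁻¹ conj(ĥ_p(ξ)) ĝ_p(ξ + α)` against
`f̂(ξ) conj(v̂(ξ + α))`. If `Θ` commutes with translations this function is constant, and by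
uniqueness of the coefficients of an almost periodic function, recovered through Gaussian
means, all those with `α ≠ 0` vanish; if `Θ = 0` they all do. Conversely, when all of them vanish,
so does `⟨Θ f, v⟩`, and the functions of bounded spectrum in a shell are total in `L²(ℝᵈ)`.
-/

/-! ### Periodization and Parseval's identity -/

section Periodization

attribute [local instance] instMeasureSpaceUnitAddCircle

theorem integrable_of_memLp_of_isBounded_support {X E : Type*} [PseudoMetricSpace X]
    [ProperSpace X] [MeasurableSpace X] {μ : Measure X} [IsFiniteMeasureOnCompacts μ]
    [NormedAddCommGroup E] {F : X → E} {p : ℝ≥0∞} (hp : 1 ≤ p) (hF : MemLp F p μ)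
    (hFb : Bornology.IsBounded (Function.support F)) : Integrable F μ :=
  memLp_one_iff_integrable.1 <| hF.mono_exponent_of_measure_support_ne_top
    (fun _ => Function.notMem_support.1) hFb.measure_lt_top.ne hp

variable {ι : Type*}

/-- The half-open unit box `(0, 1]ᶥ`, a fundamental domain for the action of `ℤᶥ` on `ℝᶥ`. The
interval is written as in `UnitAddTorus.measurableEquivPiIoc`. -/
def unitBox (ι : Type*) : Set (ι → ℝ) := {x | ∀ i, x i ∈ Set.Ioc (0 : ℝ) (0 + 1)}

theorem isBounded_unitBox [Finite ι] : Bornology.IsBounded (unitBox ι) :=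
  have := Fintype.ofFinite ι
  (Bornology.forall_isBounded_image_eval_iff).1 fun i =>
    (Metric.isBounded_Ioc (0 : ℝ) (0 + 1)).subset (Set.image_subset_iff.2 fun _ hx => hx i)

theorem measurableSet_unitBox [Countable ι] : MeasurableSet (unitBox ι) :=
  MeasurableSet.univ_pi' fun _ => measurableSet_Ioc

theorem existsUnique_sub_intCast_mem_unitBox (x : ι → ℝ) :
    ∃! n : ι → ℤ, (x - fun i => (n i : ℝ)) ∈ unitBox ι := by
  choose n hn huniq using fun i => existsUnique_sub_zsmul_mem_Ioc one_pos (x i) (0 : ℝ)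
  simp only [zsmul_eq_mul, mul_one] at hn huniq
  exact ⟨n, hn, fun m hm => funext fun i => huniq i (m i) (hm i)⟩

open scoped Pointwise in
theorem finite_setOf_exists_add_intCast_mem [Finite ι] {A B : Set (ι → ℝ)}
    (hA : Bornology.IsBounded A) (hB : Bornology.IsBounded B) :
    {n : ι → ℤ | ∃ x ∈ A, (x + fun i => (n i : ℝ)) ∈ B}.Finite := by
  have := Fintype.ofFinite ι
  have hcast : AntilipschitzWith 1 fun (n : ι → ℤ) (i : ι) => (n i : ℝ) :=
    AntilipschitzWith.of_le_mul_dist fun m n => by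
      simp only [NNReal.coe_one, one_mul]
      exact (dist_pi_le_iff dist_nonneg).2 fun i =>
        dist_le_pi_dist (fun i => (m i : ℝ)) (fun i => (n i : ℝ)) i
  have hbdd : Bornology.IsBounded {n : ι → ℤ | (fun i => (n i : ℝ)) ∈ B - A} :=
    hcast.isBounded_preimage (hB.sub hA)
  refine (Metric.finite_isBounded_inter_isClosed
    DiscreteTopology.isDiscrete hbdd isClosed_univ).subset fun n hn => ?_
  obtain ⟨x, hx, hxn⟩ := hn
  exact ⟨Set.mem_sub.2 ⟨_, hxn, x, hx, add_sub_cancel_left _ _⟩, trivial⟩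

theorem exists_finset_forall_mem_unitBox [Finite ι] {F : (ι → ℝ) → ℂ}
    (hF : Bornology.IsBounded (Function.support F)) :
    ∃ S : Finset (ι → ℤ), ∀ n ∉ S, ∀ x ∈ unitBox ι, F (x + fun i => (n i : ℝ)) = 0 := by
  refine ⟨(finite_setOf_exists_add_intCast_mem isBounded_unitBox hF).toFinset,
    fun n hn x hx => ?_⟩
  by_contra h
  exact hn ((Set.Finite.mem_toFinset _).2 ⟨x, hx, h⟩)

/-- The section of `ℝᶥ → (ℝ/ℤ)ᶥ` with values in the unit box. -/
noncomputable def torusSection (t : UnitAddTorus ι) : ι → ℝ :=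
  (UnitAddTorus.measurableEquivPiIoc 0 t).1

theorem torusSection_mem_unitBox (t : UnitAddTorus ι) : torusSection t ∈ unitBox ι :=
  (UnitAddTorus.measurableEquivPiIoc 0 t).2

theorem exists_torusSection_coe_eq_add (x : ι → ℝ) :
    ∃ n : ι → ℤ, torusSection (fun i => (x i : UnitAddCircle)) = x + fun i => (n i : ℝ) := by
  have h (i : ι) : ∃ n : ℤ, torusSection (fun i => (x i : UnitAddCircle)) i = x i + n := by
    have hcoe : ((torusSection (fun i => (x i : UnitAddCircle)) i - x i : ℝ) :
        UnitAddCircle) = 0 := by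
      rw [AddCircle.coe_sub, sub_eq_zero]
      exact AddCircle.coe_equivIoc (p := (1 : ℝ)) (a := 0) (y := (x i : UnitAddCircle))
    obtain ⟨n, hn⟩ := (AddCircle.coe_eq_zero_iff (1 : ℝ)).1 hcoe
    exact ⟨n, by rw [zsmul_eq_mul, mul_one] at hn; rw [hn, add_sub_cancel]⟩
  choose n hn using h
  exact ⟨n, funext hn⟩

/-- The `ℤᶥ`-periodization `∑ₙ F(· + n)` of `F`, as a function on the torus. -/
noncomputable def periodization (F : (ι → ℝ) → ℂ) (t : UnitAddTorus ι) : ℂ :=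
  ∑' n : ι → ℤ, F (torusSection t + fun i => (n i : ℝ))

theorem periodization_coe (F : (ι → ℝ) → ℂ) (x : ι → ℝ) :
    periodization F (fun i => (x i : UnitAddCircle)) =
      ∑' n : ι → ℤ, F (x + fun i => (n i : ℝ)) := by
  obtain ⟨m, hm⟩ := exists_torusSection_coe_eq_add x
  rw [periodization, hm, ← (Equiv.addLeft m).tsum_eq fun n : ι → ℤ => F (x + fun i => (n i : ℝ))]
  refine tsum_congr fun n => congrArg F ?_
  ext i
  simp [add_assoc]

variable [Fintype ι]

theorem hasSum_setIntegral_unitBox {φ : (ι → ℝ) → ℂ} (hφ : Integrable φ) :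
    HasSum (fun n : ι → ℤ => ∫ x in unitBox ι, φ (x + fun i => (n i : ℝ))) (∫ x, φ x) := by
  let box (n : ι → ℤ) : Set (ι → ℝ) := (· - fun i => (n i : ℝ)) ⁻¹' unitBox ι
  have hmeas (n : ι → ℤ) : MeasurableSet (box n) :=
    measurableSet_unitBox.preimage (measurable_sub_const _)
  have hcover : ⋃ n, box n = Set.univ := Set.eq_univ_of_forall fun x =>
    Set.mem_iUnion.2 (existsUnique_sub_intCast_mem_unitBox x).exists
  have hdisj : Pairwise (Function.onFun Disjoint box) := fun m n hmn =>
    Set.disjoint_left.2 fun x hm hn => hmn ((existsUnique_sub_intCast_mem_unitBox x).unique hm hn)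
  have hsum := hasSum_integral_iUnion hmeas hdisj hφ.integrableOn
  rw [hcover, setIntegral_univ] at hsum
  refine hsum.congr_fun fun n => ?_
  rw [← (measurePreserving_sub_right volume fun i => (n i : ℝ)).setIntegral_preimage_emb
    (MeasurableEquiv.subRight _).measurableEmbedding]
  simp only [sub_add_cancel, box]

theorem measurePreserving_torusSection :
    MeasurePreserving (torusSection (ι := ι)) volume (volume.restrict (unitBox ι)) :=
  (measurePreserving_subtype_coe measurableSet_unitBox).comp
    (UnitAddTorus.measurePreserving_equivPiIoc 0)

theorem memLp_periodization {F : (ι → ℝ) → ℂ} (hF : MemLp F 2)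
    (hFb : Bornology.IsBounded (Function.support F)) : MemLp (periodization F) 2 := by
  obtain ⟨S, hS⟩ := exists_finset_forall_mem_unitBox hFb
  have hfin : periodization F =
      (fun x => ∑ n ∈ S, F (x + fun i => (n i : ℝ))) ∘ torusSection :=
    funext fun t => tsum_eq_sum fun n hn => hS n hn _ (torusSection_mem_unitBox t)
  rw [hfin]
  refine MemLp.comp_measurePreserving ?_ measurePreserving_torusSection
  exact (memLp_finsetSum S fun n _ =>
    hF.comp_measurePreserving (measurePreserving_add_right volume _)).restrict _

theorem integral_periodization_mul {F : (ι → ℝ) → ℂ} {u : UnitAddTorus ι → ℂ}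
    (hFb : Bornology.IsBounded (Function.support F))
    (hFu : Integrable fun x : ι → ℝ => F x * u fun i => (x i : UnitAddCircle)) :
    ∫ t, periodization F t * u t = ∫ x : ι → ℝ, F x * u fun i => (x i : UnitAddCircle) := by
  obtain ⟨S, hS⟩ := exists_finset_forall_mem_unitBox hFb
  have hcoe (x : ι → ℝ) (n : ι → ℤ) :
      (fun i => (((x + fun i => (n i : ℝ)) i : ℝ) : UnitAddCircle)) =
        fun i => (x i : UnitAddCircle) := by
    ext i
    simp
  have hsum := hasSum_setIntegral_unitBox hFu
  have hint (n : ι → ℤ) := (hFu.comp_add_right fun i => (n i : ℝ)).integrableOn (s := unitBox ι)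
  simp only [hcoe] at hsum hint
  calc ∫ t, periodization F t * u t
      = ∫ x in unitBox ι, ∑ n ∈ S,
          F (x + fun i => (n i : ℝ)) * u fun i => (x i : UnitAddCircle) := by
        rw [UnitAddTorus.integral_preimage _ 0]
        refine setIntegral_congr_fun measurableSet_unitBox fun x hx => ?_
        rw [periodization_coe, tsum_eq_sum fun n hn => hS n hn x hx, Finset.sum_mul]
    _ = ∑ n ∈ S, ∫ x in unitBox ι, F (x + fun i => (n i : ℝ)) * u fun i => (x i : UnitAddCircle) :=
        integral_finsetSum S fun n _ => hint n
    _ = ∫ x : ι → ℝ, F x * u fun i => (x i : UnitAddCircle) := by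
        rw [← hsum.tsum_eq]
        refine (tsum_eq_sum fun n hn => setIntegral_eq_zero_of_forall_eq_zero fun x hx => ?_).symm
        rw [hS n hn x hx, zero_mul]

theorem mFourier_coe (k : ι → ℤ) (x : ι → ℝ) :
    UnitAddTorus.mFourier k (fun i => (x i : UnitAddCircle)) = (𝐞 (∑ i, (k i : ℝ) * x i) : ℂ) := by
  simp only [UnitAddTorus.mFourier, ContinuousMap.coe_mk, fourier_coe_apply,
    Real.fourierChar_apply, ← Complex.exp_sum]
  push_cast
  simp only [Finset.mul_sum, Finset.sum_mul, div_one]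
  exact congrArg _ (Finset.sum_congr rfl fun i _ => by ring)

theorem mFourierCoeff_periodization {F : (ι → ℝ) → ℂ} (hF : MemLp F 2)
    (hFb : Bornology.IsBounded (Function.support F)) (k : ι → ℤ) :
    UnitAddTorus.mFourierCoeff (periodization F) (-k) =
      ∫ x, F x * (𝐞 (∑ i, (k i : ℝ) * x i) : ℂ) := by
  have hcont : Continuous fun x : ι → ℝ => (𝐞 (∑ i, (k i : ℝ) * x i) : ℂ) :=
    continuous_subtype_val.comp (Real.continuous_fourierChar.comp (by fun_prop))
  have hint : Integrable fun x => F x * (𝐞 (∑ i, (k i : ℝ) * x i) : ℂ) :=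
    (integrable_of_memLp_of_isBounded_support one_le_two hF hFb).mul_bdd (c := 1)
      hcont.aestronglyMeasurable (.of_forall fun x => (Circle.norm_coe _).le)
  simp only [← mFourier_coe] at hint ⊢
  rw [← integral_periodization_mul hFb hint, UnitAddTorus.mFourierCoeff, neg_neg]
  simp only [smul_eq_mul, mul_comm]

theorem hasSum_integral_mul_conj_comp_add_intCast {F G : (ι → ℝ) → ℂ} (hF : MemLp F 2)
    (hG : MemLp G 2) (hFb : Bornology.IsBounded (Function.support F))
    (hGb : Bornology.IsBounded (Function.support G)) :
    HasSum (fun n : ι → ℤ => ∫ x, F x * (starRingEnd ℂ) (G (x + fun i => (n i : ℝ))))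
      (∫ t, periodization F t * (starRingEnd ℂ) (periodization G t)) := by
  have hfin := finite_setOf_exists_add_intCast_mem hFb hGb
  set D := hfin.toFinset
  have hD (n : ι → ℤ) (hn : n ∉ D) (x : ι → ℝ) :
      F x * (starRingEnd ℂ) (G (x + fun i => (n i : ℝ))) = 0 := by
    by_contra h
    refine hn (hfin.mem_toFinset.2 ⟨x, left_ne_zero_of_mul h, ?_⟩)
    exact (map_ne_zero (starRingEnd ℂ)).1 (right_ne_zero_of_mul h)
  have hint (n : ι → ℤ) : Integrable fun x => F x * (starRingEnd ℂ) (G (x + fun i => (n i : ℝ))) :=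
    hF.integrable_mul (hG.comp_measurePreserving (measurePreserving_add_right volume _)).star
  have hunfold (x : ι → ℝ) :
      F x * (starRingEnd ℂ) (periodization G fun i => (x i : UnitAddCircle)) =
        ∑ n ∈ D, F x * (starRingEnd ℂ) (G (x + fun i => (n i : ℝ))) := by
    rw [periodization_coe, Complex.conj_tsum, ← tsum_mul_left,
      tsum_eq_sum fun n hn => hD n hn x]
  rw [integral_periodization_mul (u := fun t => (starRingEnd ℂ) (periodization G t)) hFb]
  · simp only [hunfold]
    rw [integral_finsetSum D fun n _ => hint n]
    exact hasSum_sum_of_ne_finset_zero fun n hn => by simp only [hD n hn, integral_zero]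
  · simp only [hunfold]
    exact integrable_finsetSum D fun n _ => hint n

theorem hasSum_integer_samples {F G : (ι → ℝ) → ℂ} (hF : MemLp F 2) (hG : MemLp G 2)
    (hFb : Bornology.IsBounded (Function.support F))
    (hGb : Bornology.IsBounded (Function.support G)) :
    HasSum (fun k : ι → ℤ => (∫ x, F x * (𝐞 (∑ i, (k i : ℝ) * x i) : ℂ)) *
        (starRingEnd ℂ) (∫ x, G x * (𝐞 (∑ i, (k i : ℝ) * x i) : ℂ)))
      (∑' n : ι → ℤ, ∫ x, F x * (starRingEnd ℂ) (G (x + fun i => (n i : ℝ)))) := by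
  have hPF := memLp_periodization hF hFb
  have hPG := memLp_periodization hG hGb
  have hcoeff {u : UnitAddTorus ι → ℂ} (hu : MemLp u 2) (k : ι → ℤ) :
      UnitAddTorus.mFourierCoeff (hu.toLp u) k = UnitAddTorus.mFourierCoeff u k := by
    refine integral_congr_ae ?_
    filter_upwards [hu.coeFn_toLp] with t ht
    rw [ht]
  have hparseval := UnitAddTorus.hasSum_prod_mFourierCoeff (hPG.toLp _) (hPF.toLp _)
  rw [← (Equiv.neg (ι → ℤ)).hasSum_iff] at hparseval
  rw [(hasSum_integral_mul_conj_comp_add_intCast hF hG hFb hGb).tsum_eq]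
  convert hparseval using 1
  · ext k
    simp only [Function.comp, Equiv.neg_apply, hcoeff]
    rw [mFourierCoeff_periodization hF hFb, mFourierCoeff_periodization hG hGb, mul_comm]
  · refine integral_congr_ae ?_
    filter_upwards [hPF.coeFn_toLp, hPG.coeFn_toLp] with t hFt hGt
    rw [hFt, hGt, mul_comm]

end Periodization

/-! ### Characters -/

section Character

variable {V : Type*} [NormedAddCommGroup V] [InnerProductSpace ℝ V]

/-- The character `ξ ↦ exp(2πi ⟨x, ξ⟩)` of a real inner product space, as a complex function. -/
noncomputable def character (x ξ : V) : ℂ := (𝐞 (inner ℝ x ξ) : ℂ)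

@[simp]
theorem norm_character (x ξ : V) : ‖character x ξ‖ = 1 := Circle.norm_coe _

theorem character_add_right (x ξ η : V) :
    character x (ξ + η) = character x ξ * character x η := by
  simp [character, inner_add_right, AddChar.map_add_eq_mul]

theorem conj_character (x ξ : V) : (starRingEnd ℂ) (character x ξ) = character x (-ξ) := by
  simp [character, inner_neg_right, AddChar.map_neg_eq_inv]

theorem character_neg_left (x ξ : V) : character (-x) ξ = character x (-ξ) := by
  simp [character]

@[fun_prop]
theorem continuous_character (x : V) : Continuous (character x) :=
  continuous_subtype_val.comp (Real.continuous_fourierChar.comp (by fun_prop))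

end Character

/-! ### The Fourier transform on `L²(ℝᵈ)` -/

section Fourier

variable {d : ℕ}

theorem memLp_fhat (f : L2Rd d) : MemLp (fhat f) 2 := Lp.memLp (𝓕 f : L2Rd d)

theorem aestronglyMeasurable_fhat (f : L2Rd d) : AEStronglyMeasurable (fhat f) :=
  (memLp_fhat f).aestronglyMeasurable

theorem inner_eq_integral_fhat (f g : L2Rd d) :
    inner ℂ f g = ∫ ξ, (starRingEnd ℂ) (fhat f ξ) * fhat g ξ := by
  rw [← Lp.inner_fourier_eq f g, L2.inner_def]
  exact integral_congr_ae (.of_forall fun ξ => RCLike.inner_apply' _ _)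

theorem eq_zero_of_fhat_ae_eq_zero {f : L2Rd d} (hf : fhat f =ᵐ[volume] 0) : f = 0 := by
  have h : (𝓕 f : L2Rd d) = 0 := Lp.eq_zero_iff_ae_eq_zero.2 hf
  exact (Lp.fourierTransformₗᵢ (Rd d) ℂ).map_eq_zero_iff.1 h

theorem memLp_character (x : Rd d) : MemLp (character x) ∞ :=
  memLp_top_of_bound (continuous_character x).aestronglyMeasurable 1
    (.of_forall fun ξ => (norm_character x ξ).le)

/-- The modulation operator `f ↦ exp(2πi ⟨x, ·⟩) f` on `L²(ℝᵈ)`. -/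
noncomputable def modulation (x : Rd d) : L2Rd d →L[ℂ] L2Rd d :=
  (ContinuousLinearMap.mul ℂ ℂ).holderL volume ∞ 2 2 ((memLp_character x).toLp _)

theorem coeFn_modulation (x : Rd d) (f : L2Rd d) :
    modulation x f =ᵐ[volume] fun ξ => character x ξ * f ξ := by
  filter_upwards [(ContinuousLinearMap.mul ℂ ℂ).coeFn_holder (r := 2)
    ((memLp_character x).toLp _) f, (memLp_character x).coeFn_toLp] with ξ h₁ h₂
  exact h₁.trans (by rw [h₂]; rfl)

theorem coeFn_translation (β : Rd d) (f : L2Rd d) :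
    translation β f =ᵐ[volume] fun x => f (x - β) :=
  Lp.coeFn_compMeasurePreserving f (measurePreserving_sub_right volume β)

theorem translation_toLp (β : Rd d) (f : SchwartzMap (Rd d) ℂ) :
    translation β (f.toLp 2) = (SchwartzMap.compSubConstCLM ℂ β f).toLp 2 := by
  refine Lp.ext ?_
  filter_upwards [coeFn_translation β (f.toLp 2),
    (measurePreserving_sub_right volume β).quasiMeasurePreserving.ae_eq_comp
      (SchwartzMap.coeFn_toLp f 2 volume),
    SchwartzMap.coeFn_toLp (SchwartzMap.compSubConstCLM ℂ β f) 2 volume] with x h₁ h₂ h₃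
  rw [h₁, h₃]
  exact h₂

theorem fourier_compSubConstCLM (β : Rd d) (f : SchwartzMap (Rd d) ℂ) (ξ : Rd d) :
    𝓕 (SchwartzMap.compSubConstCLM ℂ β f) ξ = character (-β) ξ * 𝓕 f ξ := by
  rw [SchwartzMap.fourier_coe, SchwartzMap.fourier_coe]
  exact congrFun (VectorFourier.fourierIntegral_comp_add_right 𝐞 (volume : Measure (Rd d))
    (innerₗ (Rd d)) (f : Rd d → ℂ) (-β)) ξ

theorem fourier_translation (β : Rd d) (f : L2Rd d) :
    (𝓕 (translation β f) : L2Rd d) = modulation (-β) (𝓕 f : L2Rd d) := by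
  have hdense : DenseRange (SchwartzMap.toLpCLM ℂ (E := Rd d) ℂ 2 volume) :=
    SchwartzMap.denseRange_toLpCLM ENNReal.ofNat_ne_top
  have hcont := (Lp.fourierTransformₗᵢ (Rd d) ℂ).continuous
  refine hdense.induction_on (p := fun f : L2Rd d =>
    (𝓕 (translation β f) : L2Rd d) = modulation (-β) (𝓕 f : L2Rd d)) f
    (isClosed_eq (hcont.comp (translation β).continuous)
      ((modulation (-β)).continuous.comp hcont)) fun f => ?_
  change (𝓕 (translation β (f.toLp 2)) : L2Rd d) = modulation (-β) (𝓕 (f.toLp 2) : L2Rd d)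
  rw [translation_toLp, SchwartzMap.toLp_fourier_eq, SchwartzMap.toLp_fourier_eq]
  refine Lp.ext ?_
  filter_upwards [SchwartzMap.coeFn_toLp (𝓕 (SchwartzMap.compSubConstCLM ℂ β f)) 2 volume,
    SchwartzMap.coeFn_toLp (𝓕 f) 2 volume, coeFn_modulation (-β) ((𝓕 f).toLp 2)] with ξ h₁ h₂ h₃
  rw [h₁, h₃, h₂, fourier_compSubConstCLM]

theorem fhat_translation (β : Rd d) (f : L2Rd d) :
    fhat (translation β f) =ᵐ[volume] fun ξ => character (-β) ξ * fhat f ξ := by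
  rw [fhat, fourier_translation]
  exact coeFn_modulation (-β) _

theorem ae_norm_fhat_translation (β : Rd d) (f : L2Rd d) :
    ∀ᵐ ξ, ‖fhat (translation β f) ξ‖ = ‖fhat f ξ‖ := by
  filter_upwards [fhat_translation β f] with ξ hξ
  rw [hξ, norm_mul, norm_character, one_mul]

/-- The function in `L²(ℝᵈ)` whose Fourier transform is the indicator function of `E`. -/
noncomputable def bandlimited {E : Set (Rd d)} (hE : MeasurableSet E) (hE' : volume E ≠ ∞) :
    L2Rd d :=
  (𝓕⁻ (indicatorConstLp 2 hE hE' (1 : ℂ)) : L2Rd d)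

theorem fhat_bandlimited {E : Set (Rd d)} (hE : MeasurableSet E) (hE' : volume E ≠ ∞) :
    fhat (bandlimited hE hE') =ᵐ[volume] E.indicator 1 := by
  rw [fhat, bandlimited, FourierTransform.fourier_fourierInv_eq]
  exact indicatorConstLp_coeFn

theorem inner_bandlimited {E : Set (Rd d)} (hE : MeasurableSet E) (hE' : volume E ≠ ∞)
    (f : L2Rd d) : inner ℂ (bandlimited hE hE') f = ∫ ξ in E, fhat f ξ := by
  rw [inner_eq_integral_fhat, ← integral_indicator hE]
  refine integral_congr_ae ?_
  filter_upwards [fhat_bandlimited hE hE'] with ξ hξ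
  by_cases h : ξ ∈ E <;> simp [hξ, h]

end Fourier

/-! ### Parseval's identity on a lattice -/

section Lattice

variable {d : ℕ} {C : Matrix (Fin d) (Fin d) ℝ}

theorem isUnit_det_transpose (hC : IsUnit C.det) : IsUnit Cᵀ.det := by
  rwa [Matrix.det_transpose]

/-- The linear parametrization `η ↦ C' η` of `ℝᵈ`, which maps `ℤᵈ` onto the lattice dual to
`C ℤᵈ`. -/
noncomputable def dualEquiv (hC : IsUnit C.det) : (Fin d → ℝ) ≃L[ℝ] Rd d :=
  (Matrix.toLin'OfInv (Matrix.mul_nonsing_inv _ (isUnit_det_transpose hC))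
      (Matrix.nonsing_inv_mul _ (isUnit_det_transpose hC))).toContinuousLinearEquiv.trans
    (EuclideanSpace.equiv (Fin d) ℝ).symm

theorem dualEquiv_symm_apply (hC : IsUnit C.det) (ξ : Rd d) :
    (dualEquiv hC).symm ξ = Cᵀ *ᵥ fun i => ξ i := rfl

theorem dualEquiv_intCast (hC : IsUnit C.det) (n : Fin d → ℤ) :
    dualEquiv hC (fun i => (n i : ℝ)) = latticePoint (contragredient C) n := rfl

theorem inner_latticePoint_dualEquiv (hC : IsUnit C.det) (k : Fin d → ℤ) (η : Fin d → ℝ) :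
    inner ℝ (latticePoint C k) (dualEquiv hC η) = ∑ i, (k i : ℝ) * η i := by
  obtain ⟨ξ, rfl⟩ := (dualEquiv hC).symm.surjective η
  rw [ContinuousLinearEquiv.apply_symm_apply, dualEquiv_symm_apply,
    EuclideanSpace.inner_eq_star_dotProduct, star_trivial]
  change _ = (fun i => (k i : ℝ)) ⬝ᵥ _
  rw [Matrix.dotProduct_mulVec, Matrix.vecMul_transpose, dotProduct_comm]
  rfl

theorem map_dualEquiv_volume (hC : IsUnit C.det) :
    Measure.map (dualEquiv hC) volume = ENNReal.ofReal |C.det| • volume := by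
  have hdet : (contragredient C).det = C.det⁻¹ := by
    simp [contragredient, Matrix.det_nonsing_inv]
  have hdet0 : (contragredient C).det ≠ 0 := hdet ▸ inv_ne_zero hC.ne_zero
  have hcomp : ⇑(dualEquiv hC) = WithLp.toLp 2 ∘ Matrix.toLin' (contragredient C) := rfl
  rw [hcomp, ← Measure.map_map (PiLp.volume_preserving_toLp (Fin d)).measurable
    (Matrix.toLin' (contragredient C)).continuous_of_finiteDimensional.measurable,
    Real.map_matrix_volume_pi_eq_smul_volume_pi hdet0, Measure.map_smul,
    (PiLp.volume_preserving_toLp (Fin d)).map_eq, hdet, inv_inv]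

theorem measurableEmbedding_dualEquiv (hC : IsUnit C.det) : MeasurableEmbedding (dualEquiv hC) :=
  (dualEquiv hC).toHomeomorph.measurableEmbedding

theorem integral_comp_dualEquiv (hC : IsUnit C.det) (φ : Rd d → ℂ) :
    ∫ η, φ (dualEquiv hC η) = (|C.det| : ℝ) * ∫ ξ, φ ξ := by
  rw [← (measurableEmbedding_dualEquiv hC).integral_map, map_dualEquiv_volume hC,
    integral_smul_measure, ENNReal.toReal_ofReal (abs_nonneg _), Complex.real_smul]

theorem memLp_comp_dualEquiv (hC : IsUnit C.det) {φ : Rd d → ℂ} {p : ℝ≥0∞} (hφ : MemLp φ p) :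
    MemLp (fun η => φ (dualEquiv hC η)) p := by
  refine (measurableEmbedding_dualEquiv hC).memLp_map_measure_iff.1 ?_
  rw [map_dualEquiv_volume hC]
  exact hφ.smul_measure ENNReal.ofReal_ne_top

theorem isBounded_support_comp_dualEquiv (hC : IsUnit C.det) {φ : Rd d → ℂ}
    (hφ : Bornology.IsBounded (Function.support φ)) :
    Bornology.IsBounded (Function.support fun η => φ (dualEquiv hC η)) :=
  (dualEquiv hC).antilipschitz.isBounded_preimage hφ

theorem integral_comp_dualEquiv_mul_fourierChar (hC : IsUnit C.det) (φ : Rd d → ℂ)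
    (k : Fin d → ℤ) :
    ∫ η, φ (dualEquiv hC η) * (𝐞 (∑ i, (k i : ℝ) * η i) : ℂ) =
      (|C.det| : ℝ) * ∫ ξ, φ ξ * character (latticePoint C k) ξ := by
  rw [← integral_comp_dualEquiv hC]
  simp only [character, inner_latticePoint_dualEquiv hC]

theorem hasSum_lattice_samples (hC : IsUnit C.det) {F G : Rd d → ℂ}
    (hF : MemLp F 2) (hG : MemLp G 2)
    (hFb : Bornology.IsBounded (Function.support F))
    (hGb : Bornology.IsBounded (Function.support G)) :
    HasSum (fun k : Fin d → ℤ => (∫ ξ, F ξ * character (latticePoint C k) ξ) *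
        (starRingEnd ℂ) (∫ ξ, G ξ * character (latticePoint C k) ξ))
      (∑' n : Fin d → ℤ, (|C.det|⁻¹ : ℝ) *
        ∫ ξ, F ξ * (starRingEnd ℂ) (G (ξ + latticePoint (contragredient C) n))) := by
  have hdet : ((|C.det| : ℝ) : ℂ) ≠ 0 :=
    Complex.ofReal_ne_zero.2 (abs_ne_zero.2 hC.ne_zero)
  have hsamples := hasSum_integer_samples (memLp_comp_dualEquiv hC hF) (memLp_comp_dualEquiv hC hG)
    (isBounded_support_comp_dualEquiv hC hFb) (isBounded_support_comp_dualEquiv hC hGb)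
  have hcorr (n : Fin d → ℤ) :
      ∫ η, F (dualEquiv hC η) * (starRingEnd ℂ) (G (dualEquiv hC (η + fun i => (n i : ℝ)))) =
        (|C.det| : ℝ) *
          ∫ ξ, F ξ * (starRingEnd ℂ) (G (ξ + latticePoint (contragredient C) n)) := by
    simp only [map_add, dualEquiv_intCast]
    exact integral_comp_dualEquiv hC fun ξ =>
      F ξ * (starRingEnd ℂ) (G (ξ + latticePoint (contragredient C) n))
  simp only [integral_comp_dualEquiv_mul_fourierChar hC, hcorr, map_mul, Complex.conj_ofReal,
    tsum_mul_left] at hsamples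
  have hscaled := hsamples.mul_left (((|C.det| : ℝ) : ℂ)⁻¹ ^ 2)
  have hterm (a b : ℂ) : ((|C.det| : ℝ) : ℂ)⁻¹ ^ 2 * ((|C.det| : ℝ) * a * ((|C.det| : ℝ) * b)) =
      a * b := by
    field_simp
  have hvalue (a : ℂ) : ((|C.det| : ℝ) : ℂ)⁻¹ ^ 2 * ((|C.det| : ℝ) * a) =
      ((|C.det|⁻¹ : ℝ) : ℂ) * a := by
    push_cast
    field_simp
  simpa only [hterm, hvalue, tsum_mul_left] using hscaled

end Lattice

/-! ### Uniqueness for absolutely convergent series of characters -/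

section Uniqueness

variable {V : Type*} [NormedAddCommGroup V] [InnerProductSpace ℝ V]

theorem gaussian_mul_character (b : ℝ) (α x : V) :
    Complex.exp (-b * (‖x‖ : ℂ) ^ 2) * character x α =
      Complex.exp (-b * (‖x‖ : ℂ) ^ 2 + 2 * Real.pi * Complex.I * (inner ℝ α x : ℝ)) := by
  rw [character, Real.fourierChar_apply, ← Complex.exp_add, real_inner_comm]
  push_cast
  ring_nf

variable [FiniteDimensional ℝ V] [MeasurableSpace V] [BorelSpace V]

theorem integrable_gaussian_mul_character {b : ℝ} (hb : 0 < b) (α : V) :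
    Integrable fun x : V => Complex.exp (-b * (‖x‖ : ℂ) ^ 2) * character x α := by
  simp only [gaussian_mul_character]
  exact GaussianFourier.integrable_cexp_neg_mul_sq_norm_add (by simpa using hb) _ α

theorem integral_gaussian_mul_character {b : ℝ} (hb : 0 < b) (α : V) :
    ∫ x : V, Complex.exp (-b * (‖x‖ : ℂ) ^ 2) * character x α =
      (∫ x : V, Complex.exp (-b * (‖x‖ : ℂ) ^ 2)) *
        (Real.exp (-(Real.pi ^ 2 * ‖α‖ ^ 2 / b)) : ℂ) := by
  have hb' : 0 < (b : ℂ).re := by simpa using hb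
  have hb0 : (b : ℂ) ≠ 0 := Complex.ofReal_ne_zero.2 hb.ne'
  simp only [gaussian_mul_character]
  rw [GaussianFourier.integral_cexp_neg_mul_sq_norm_add hb',
    GaussianFourier.integral_cexp_neg_mul_sq_norm hb']
  congr 1
  push_cast
  congr 1
  rw [mul_pow, mul_pow, Complex.I_sq]
  field_simp
  ring

/-- The mean of `F` with respect to the Gaussian density proportional to `exp(-b ‖x‖²)`. As
`b → 0⁺` it recovers the Bohr mean of an almost periodic function. -/
noncomputable def gaussianMean (b : ℝ) (F : V → ℂ) : ℂ :=
  (∫ x : V, Complex.exp (-b * (‖x‖ : ℂ) ^ 2))⁻¹ *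
    ∫ x : V, Complex.exp (-b * (‖x‖ : ℂ) ^ 2) * F x

theorem gaussianMean_character {b : ℝ} (hb : 0 < b) (α : V) :
    gaussianMean b (fun x => character x α) = (Real.exp (-(Real.pi ^ 2 * ‖α‖ ^ 2 / b)) : ℂ) := by
  have hmass : ∫ x : V, Complex.exp (-b * (‖x‖ : ℂ) ^ 2) ≠ 0 := by
    rw [GaussianFourier.integral_cexp_neg_mul_sq_norm (by simpa using hb),
      Complex.cpow_ne_zero_iff]
    exact Or.inl (div_ne_zero (Complex.ofReal_ne_zero.2 Real.pi_ne_zero)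
      (Complex.ofReal_ne_zero.2 hb.ne'))
  rw [gaussianMean, integral_gaussian_mul_character hb, inv_mul_cancel_left₀ hmass]

theorem norm_gaussianMean_character_le {b : ℝ} (hb : 0 < b) (α : V) :
    ‖gaussianMean b fun x => character x α‖ ≤ 1 := by
  rw [gaussianMean_character hb, Complex.norm_real, Real.norm_eq_abs, Real.abs_exp,
    Real.exp_le_one_iff, neg_nonpos]
  positivity

theorem gaussianMean_const_mul (b : ℝ) (c : ℂ) (F : V → ℂ) :
    gaussianMean b (fun x => c * F x) = c * gaussianMean b F := by
  simp only [gaussianMean, mul_left_comm _ c, integral_const_mul]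

theorem gaussianMean_tsum_character {ι : Type*} [Countable ι] {b : ℝ} (hb : 0 < b) {c : ι → ℂ}
    (hc : Summable fun i => ‖c i‖) (α : ι → V) :
    gaussianMean b (fun x => ∑' i, c i * character x (α i)) =
      ∑' i, c i * gaussianMean b fun x => character x (α i) := by
  have hint (i : ι) : Integrable fun x : V =>
      c i * (Complex.exp (-b * (‖x‖ : ℂ) ^ 2) * character x (α i)) :=
    (integrable_gaussian_mul_character hb (α i)).const_mul _
  have hnorm : Summable fun i => ∫ x : V,
      ‖c i * (Complex.exp (-b * (‖x‖ : ℂ) ^ 2) * character x (α i))‖ := by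
    simp only [norm_mul, norm_character, mul_one, integral_const_mul]
    exact hc.mul_right _
  have hsum := (hasSum_integral_of_summable_integral_norm hint hnorm).tsum_eq
  simp only [mul_left_comm (c _), tsum_mul_left] at hsum
  rw [gaussianMean, ← hsum, ← tsum_mul_left]
  refine tsum_congr fun i => ?_
  rw [← gaussianMean_const_mul, gaussianMean]

theorem tendsto_gaussianMean_character [DecidableEq V] (α : V) :
    Filter.Tendsto (fun b => gaussianMean b fun x => character x α) (𝓝[>] 0)
      (𝓝 (if α = 0 then 1 else 0)) := by
  refine Filter.Tendsto.congr' (f₁ := fun b : ℝ =>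
    (Real.exp (-(Real.pi ^ 2 * ‖α‖ ^ 2 / b)) : ℂ))
    (eventually_mem_nhdsWithin.mono fun b hb => (gaussianMean_character hb α).symm) ?_
  split_ifs with hα
  · simp [hα]
  · have hpos : 0 < Real.pi ^ 2 * ‖α‖ ^ 2 := by positivity
    rw [← Complex.ofReal_zero]
    exact (Complex.continuous_ofReal.tendsto 0).comp (Real.tendsto_exp_neg_atTop_nhds_zero.comp
      (tendsto_inv_nhdsGT_zero.const_mul_atTop hpos))

theorem tendsto_gaussianMean_tsum_character {ι : Type*} [Countable ι] {c : ι → ℂ}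
    (hc : Summable fun i => ‖c i‖) (α : ι → V) :
    Filter.Tendsto (fun b => gaussianMean b fun x => ∑' i, c i * character x (α i)) (𝓝[>] 0)
      (𝓝 (∑' i : {i // α i = 0}, c i)) := by
  classical
  have hfiber : ∑' i : {i // α i = 0}, c i = ∑' i, c i * if α i = 0 then 1 else 0 := by
    rw [← tsum_subtype_eq_of_support_subset (s := {i | α i = 0})]
    · exact tsum_congr fun i => by rw [if_pos i.2, mul_one]
    · exact fun i hi => by_contra fun h : ¬α i = 0 => hi (by simp only [if_neg h, mul_zero])
  rw [hfiber]
  refine Filter.Tendsto.congr' (eventually_mem_nhdsWithin.mono fun b hb =>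
    (gaussianMean_tsum_character hb hc α).symm) ?_
  refine tendsto_tsum_of_dominated_convergence hc
    (fun i => (tendsto_gaussianMean_character (α i)).const_mul (c i))
    (eventually_mem_nhdsWithin.mono fun b hb i => ?_)
  rw [norm_mul]
  exact mul_le_of_le_one_right (norm_nonneg _) (norm_gaussianMean_character_le hb _)

theorem tsum_fiber_eq_of_tsum_character_eq_const [DecidableEq V] {ι : Type*} [Countable ι]
    {c : ι → ℂ} (hc : Summable fun i => ‖c i‖) (α : ι → V) {K : ℂ}
    (hK : ∀ x, ∑' i, c i * character x (α i) = K) (β : V) :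
    ∑' i : {i // α i = β}, c i = if β = 0 then K else 0 := by
  have hshift (x : V) : ∑' i, c i * character x (α i - β) = K * character x (-β) := by
    simp only [sub_eq_add_neg, character_add_right, ← mul_assoc, tsum_mul_right, hK]
  have hseries := tendsto_gaussianMean_tsum_character hc fun i => α i - β
  simp only [hshift, gaussianMean_const_mul] at hseries
  have hconst := (tendsto_gaussianMean_character (-β)).const_mul K
  simp only [neg_eq_zero, mul_ite, mul_one, mul_zero] at hconst
  rw [← tendsto_nhds_unique hseries hconst]
  exact (Equiv.subtypeEquivRight fun i => (sub_eq_zero (a := α i) (b := β)).symm).tsum_eq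
    (fun i : {i // α i - β = 0} => c i)

end Uniqueness

/-! ### Pairings of functions of bounded spectrum -/

section Pairing

variable {d : ℕ} {A : Set (Rd d)} {f v : L2Rd d}

/-- The set `A ∩ (A - α)` of the points `ξ` of `A` such that `ξ + α` also lies in `A`. -/
def overlap (A : Set (Rd d)) (α : Rd d) : Set (Rd d) := {ξ | ξ ∈ A ∧ ξ + α ∈ A}

theorem measurableSet_overlap (hA : MeasurableSet A) (α : Rd d) : MeasurableSet (overlap A α) :=
  hA.inter (hA.preimage (measurable_add_const α))

/-- The functions in `L²(ℝᵈ)` whose Fourier transform is bounded by `1` and vanishes off `A`. They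
serve as test functions; unlike the functions `bandlimited`, they are stable under translation. -/
def spectralBall (A : Set (Rd d)) : Set (L2Rd d) :=
  {f | ∀ᵐ ξ, ‖fhat f ξ‖ ≤ A.indicator 1 ξ}

theorem spectralBall_mono {B : Set (Rd d)} (hAB : A ⊆ B) : spectralBall A ⊆ spectralBall B := by
  intro f hf
  change ∀ᵐ ξ, ‖fhat f ξ‖ ≤ B.indicator 1 ξ
  filter_upwards [hf] with ξ hξ
  exact hξ.trans (Set.indicator_le_indicator_of_subset hAB (fun _ => zero_le_one) ξ)

theorem translation_mem_spectralBall (hf : f ∈ spectralBall A) (x : Rd d) :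
    translation x f ∈ spectralBall A := by
  filter_upwards [hf, ae_norm_fhat_translation x f] with ξ hξ hx
  rwa [hx]

theorem bandlimited_mem_spectralBall {E : Set (Rd d)} (hE : MeasurableSet E) (hE' : volume E ≠ ∞)
    (hEA : E ⊆ A) : bandlimited hE hE' ∈ spectralBall A := by
  refine spectralBall_mono hEA ?_
  filter_upwards [fhat_bandlimited hE hE'] with ξ hξ
  by_cases h : ξ ∈ E <;> simp [hξ, h]

/-- The product of the conjugate of `ĝ` and `f̂`, cut off to `A`. For `f` in `spectralBall A` the
cutoff only selects a representative whose support is contained in `A`. -/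
noncomputable def crossSpectrum (A : Set (Rd d)) (f g : L2Rd d) : Rd d → ℂ :=
  A.indicator fun ξ => (starRingEnd ℂ) (fhat g ξ) * fhat f ξ

theorem crossSpectrum_ae_eq (hf : f ∈ spectralBall A) (g : L2Rd d) :
    crossSpectrum A f g =ᵐ[volume] fun ξ => (starRingEnd ℂ) (fhat g ξ) * fhat f ξ := by
  filter_upwards [hf] with ξ hξ
  by_cases h : ξ ∈ A
  · simp [crossSpectrum, h]
  · have hzero : fhat f ξ = 0 := by simpa [h] using hξ
    simp [crossSpectrum, h, hzero]

theorem integrable_crossSpectrum (hf : f ∈ spectralBall A) (g : L2Rd d) :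
    Integrable (crossSpectrum A f g) :=
  ((memLp_fhat g).star.integrable_mul (memLp_fhat f)).congr (crossSpectrum_ae_eq hf g).symm

theorem memLp_crossSpectrum (hf : f ∈ spectralBall A) (g : L2Rd d) :
    MemLp (crossSpectrum A f g) 2 := by
  refine (memLp_fhat g).of_le (integrable_crossSpectrum hf g).aestronglyMeasurable ?_
  filter_upwards [hf, crossSpectrum_ae_eq hf g] with ξ hξ hcross
  rw [hcross, norm_mul, RCLike.norm_conj]
  exact mul_le_of_le_one_right (norm_nonneg _)
    (hξ.trans (Set.indicator_apply_le' (fun _ => le_rfl) fun _ => zero_le_one))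

theorem isBounded_support_crossSpectrum (hA : Bornology.IsBounded A) (f g : L2Rd d) :
    Bornology.IsBounded (Function.support (crossSpectrum A f g)) :=
  hA.subset Set.support_indicator_subset

theorem inner_translation_eq_integral_crossSpectrum (hf : f ∈ spectralBall A) (g : L2Rd d)
    (y : Rd d) :
    inner ℂ (translation y g) f = ∫ ξ, crossSpectrum A f g ξ * character y ξ := by
  rw [inner_eq_integral_fhat]
  refine integral_congr_ae ?_
  filter_upwards [fhat_translation y g, crossSpectrum_ae_eq hf g] with ξ hg hcross
  rw [hg, hcross, map_mul, conj_character, character_neg_left, neg_neg]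
  ring

/-- The integral of `φ` against `f̂` times the conjugate of the shift `v̂(· + α)`. -/
noncomputable def spectralPairing (φ : Rd d → ℂ) (α : Rd d) (f v : L2Rd d) : ℂ :=
  ∫ ξ, φ ξ * (fhat f ξ * (starRingEnd ℂ) (fhat v (ξ + α)))

theorem spectralPairing_translation (φ : Rd d → ℂ) (α : Rd d) (f v : L2Rd d) (x : Rd d) :
    spectralPairing φ α (translation x f) (translation x v) =
      spectralPairing φ α f v * character x α := by
  rw [spectralPairing, spectralPairing, ← integral_mul_const]
  refine integral_congr_ae ?_
  filter_upwards [fhat_translation x f, (measurePreserving_add_right volume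
    α).quasiMeasurePreserving.ae_eq_comp (fhat_translation x v)] with ξ hf hv
  simp only [Function.comp] at hv
  have hphase : character (-x) ξ * (starRingEnd ℂ) (character (-x) (ξ + α)) = character x α := by
    rw [conj_character, ← character_add_right, character_neg_left]
    congr 1
    abel
  rw [hf, hv, map_mul, ← hphase]
  ring

theorem lintegral_enorm_mul_fhat_le (φ : Rd d → ℂ) (α : Rd d) (hf : f ∈ spectralBall A)
    (hv : v ∈ spectralBall A) :
    ∫⁻ ξ, ‖φ ξ * (fhat f ξ * (starRingEnd ℂ) (fhat v (ξ + α)))‖ₑ ≤ ∫⁻ ξ in overlap A α, ‖φ ξ‖ₑ := by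
  refine (lintegral_mono_ae ?_).trans (lintegral_indicator_le _ (overlap A α))
  filter_upwards [hf, (measurePreserving_add_right volume α).quasiMeasurePreserving.ae hv]
    with ξ hfξ hvξ
  by_cases hξ : ξ ∈ overlap A α
  · rw [Set.indicator_of_mem hξ, enorm_le_iff_norm_le, norm_mul, norm_mul, RCLike.norm_conj]
    simp only [hξ.1, hξ.2, Set.indicator_of_mem, Pi.one_apply] at hfξ hvξ
    exact mul_le_of_le_one_right (norm_nonneg _) (mul_le_one₀ hfξ (norm_nonneg _) hvξ)
  · have hzero : fhat f ξ = 0 ∨ fhat v (ξ + α) = 0 := by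
      rcases not_and_or.1 hξ with h | h
      · exact .inl (by simpa [h] using hfξ)
      · exact .inr (by simpa [h] using hvξ)
    rcases hzero with h | h <;> simp [h]

theorem enorm_spectralPairing_le (φ : Rd d → ℂ) (α : Rd d) (hf : f ∈ spectralBall A)
    (hv : v ∈ spectralBall A) : ‖spectralPairing φ α f v‖ₑ ≤ ∫⁻ ξ in overlap A α, ‖φ ξ‖ₑ :=
  (enorm_integral_le_lintegral_enorm _).trans (lintegral_enorm_mul_fhat_le φ α hf hv)

theorem tsum_spectralPairing {ι : Type*} [Countable ι] {φ : ι → Rd d → ℂ} {α : Rd d}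
    (hφ : ∀ i, AEStronglyMeasurable (φ i))
    (hsum : ∑' i, ∫⁻ ξ in overlap A α, ‖φ i ξ‖ₑ ≠ ∞)
    (hf : f ∈ spectralBall A) (hv : v ∈ spectralBall A) :
    ∑' i, spectralPairing (φ i) α f v = spectralPairing (fun ξ => ∑' i, φ i ξ) α f v := by
  have hshift : AEStronglyMeasurable fun ξ => fhat v (ξ + α) :=
    (aestronglyMeasurable_fhat v).comp_measurePreserving (measurePreserving_add_right volume α)
  simp only [spectralPairing, ← tsum_mul_right]
  refine (integral_tsum
    (fun i => (hφ i).mul ((aestronglyMeasurable_fhat f).mul hshift.star)) ?_).symm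
  exact ne_top_of_le_ne_top hsum
    (ENNReal.tsum_le_tsum fun i => lintegral_enorm_mul_fhat_le (φ i) α hf hv)

theorem spectralPairing_congr_ae {φ ψ : Rd d → ℂ} (h : φ =ᵐ[volume] ψ) (α : Rd d) (f v : L2Rd d) :
    spectralPairing φ α f v = spectralPairing ψ α f v := by
  refine integral_congr_ae ?_
  filter_upwards [h] with ξ hξ
  rw [hξ]

theorem spectralPairing_bandlimited (φ : Rd d → ℂ) (α : Rd d) (hA : MeasurableSet A)
    (hA' : volume A ≠ ∞) {E : Set (Rd d)} (hE : MeasurableSet E) (hE' : volume E ≠ ∞)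
    (hEA : E ⊆ overlap A α) :
    spectralPairing φ α (bandlimited hE hE') (bandlimited hA hA') = ∫ ξ in E, φ ξ := by
  rw [← integral_indicator hE]
  refine integral_congr_ae ?_
  filter_upwards [fhat_bandlimited hE hE', (measurePreserving_add_right volume
    α).quasiMeasurePreserving.ae_eq_comp (fhat_bandlimited hA hA')] with ξ hEξ hAξ
  simp only [Function.comp] at hAξ
  rw [hEξ, hAξ]
  by_cases h : ξ ∈ E
  · simp [h, (hEA h).2]
  · simp [h]

theorem ae_eq_zero_on_overlap_of_spectralPairing_eq_zero {φ : Rd d → ℂ} {α : Rd d}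
    (hA : MeasurableSet A) (hA' : volume A ≠ ∞) (hφ : IntegrableOn φ (overlap A α))
    (h : ∀ f ∈ spectralBall A, ∀ v ∈ spectralBall A, spectralPairing φ α f v = 0) :
    ∀ᵐ ξ, ξ ∈ overlap A α → φ ξ = 0 := by
  have hO := measurableSet_overlap hA α
  rw [← ae_restrict_iff' hO]
  refine Integrable.ae_eq_zero_of_forall_setIntegral_eq_zero hφ fun s hs _ => ?_
  have hsA : s ∩ overlap A α ⊆ A := fun ξ hξ => hξ.2.1
  have hs' : volume (s ∩ overlap A α) ≠ ∞ := measure_ne_top_of_subset hsA hA'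
  rw [Measure.restrict_restrict hs,
    ← spectralPairing_bandlimited φ α hA hA' (hs.inter hO) hs' Set.inter_subset_right]
  exact h _ (bandlimited_mem_spectralBall _ _ hsA) _ (bandlimited_mem_spectralBall _ _ subset_rfl)

end Pairing

/-! ### Local integrability -/

section LocalIntegrability

variable {d : ℕ} {P : Type*}

theorem essSupport_of_ae_eq_indicator {F : Rd d → ℂ} {A : Set (Rd d)} (hA : IsOpen A)
    (hF : F =ᵐ[volume] A.indicator 1) : essSupport F = closure A := by
  have hmeasure (U : Set (Rd d)) : volume {η | η ∈ U ∧ F η ≠ 0} = volume (U ∩ A) := by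
    refine measure_congr ?_
    filter_upwards [hF] with η hη
    refine propext ?_
    change (η ∈ U ∧ F η ≠ 0) ↔ (η ∈ U ∧ η ∈ A)
    rw [hη]
    simp
  ext ξ
  simp only [essSupport, Set.mem_ofPred_eq, hmeasure, mem_closure_iff_nhds]
  refine ⟨fun h U hU => nonempty_of_measure_ne_zero (h U hU).ne', fun h U hU => ?_⟩
  exact ((isOpen_interior.inter hA).measure_pos volume (h _ (interior_mem_nhds.2 hU))).trans_le
    (measure_mono (Set.inter_subset_inter_left _ interior_subset))

/-- The point `C_p' k` of `Λ` with index `(p, k)`. -/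
noncomputable def dualPoint (C : P → Matrix (Fin d) (Fin d) ℝ) (i : P × (Fin d → ℤ)) : Rd d :=
  latticePoint (contragredient (C i.1)) i.2

/-- The local integrability condition with the indicator function of `A` in the role of `f̂`. -/
def LocallyIntegrableSystemOn (C : P → Matrix (Fin d) (Fin d) ℝ) (g : P → L2Rd d)
    (A : Set (Rd d)) : Prop :=
  ∑' i : P × (Fin d → ℤ), ∫⁻ ξ in overlap A (dualPoint C i),
    ENNReal.ofReal (|(C i.1).det|⁻¹) * ‖fhat (g i.1) ξ‖ₑ ^ 2 ≠ ∞

theorem bandlimited_mem_testSpace {A : Set (Rd d)} (hA : IsOpen A) (hAb : Bornology.IsBounded A)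
    {r : ℝ} (hr : 0 < r) (hAr : ∀ ξ ∈ A, r ≤ ‖ξ‖) :
    bandlimited hA.measurableSet hAb.measure_lt_top.ne ∈ testSpace d := by
  have hfhat := fhat_bandlimited hA.measurableSet hAb.measure_lt_top.ne
  rw [testSpace, Set.mem_ofPred_eq, essSupport_of_ae_eq_indicator hA hfhat]
  refine ⟨MemLp.ae_eq hfhat.symm ((memLp_top_const (1 : ℂ)).indicator hA.measurableSet),
    Metric.isCompact_of_isClosed_isBounded isClosed_closure hAb.closure, r, hr, ?_⟩
  exact closure_minimal (s := A) hAr (isClosed_le continuous_const continuous_norm)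

theorem LocallyIntegrableSystem.on_of_isOpen {C : P → Matrix (Fin d) (Fin d) ℝ} {g : P → L2Rd d}
    (hg : LocallyIntegrableSystem C g) {A : Set (Rd d)} (hA : IsOpen A)
    (hAb : Bornology.IsBounded A) {r : ℝ} (hr : 0 < r) (hAr : ∀ ξ ∈ A, r ≤ ‖ξ‖) :
    LocallyIntegrableSystemOn C g A := by
  have hfhat := fhat_bandlimited hA.measurableSet hAb.measure_lt_top.ne
  refine ne_top_of_le_ne_top (hg _ (bandlimited_mem_testSpace hA hAb hr hAr)).ne ?_
  rw [ENNReal.tsum_prod', essSupport_of_ae_eq_indicator hA hfhat]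
  refine ENNReal.tsum_le_tsum fun p => ENNReal.tsum_le_tsum fun k => ?_
  have hsub : overlap A (dualPoint C (p, k)) ⊆ closure A := fun ξ hξ => subset_closure hξ.1
  refine le_trans (le_of_eq ?_) (lintegral_mono_set hsub)
  refine setLIntegral_congr_fun_ae (measurableSet_overlap hA.measurableSet _) ?_
  filter_upwards [(measurePreserving_add_right volume
    (dualPoint C (p, k))).quasiMeasurePreserving.ae_eq_comp hfhat] with ξ hξ hξA
  have hone : fhat (bandlimited hA.measurableSet hAb.measure_lt_top.ne)
      (ξ + latticePoint (contragredient (C p)) k) = 1 :=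
    hξ.trans (Set.indicator_of_mem hξA.2 1)
  simp [hone]

theorem IsBessel.locallyIntegrableSystemOn_of_dimension_zero
    {C : P → Matrix (Fin 0) (Fin 0) ℝ} {g : P → L2Rd 0}
    (hg : IsBessel (translationSystem C g)) (A : Set (Rd 0)) :
    LocallyIntegrableSystemOn C g A := by
  obtain ⟨M, hM⟩ := hg
  have hvol : (volume : Measure (Rd 0)) = Measure.dirac 0 :=
    volume_euclideanSpace_eq_dirac (Fin 0)
  have hfin : volume (Set.univ : Set (Rd 0)) ≠ ∞ := by simp [hvol]
  have hball := bandlimited_mem_spectralBall MeasurableSet.univ hfin subset_rfl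
  refine ne_top_of_le_ne_top
    (hM (bandlimited MeasurableSet.univ hfin)).1.tsum_ofReal_ne_top ?_
  refine ENNReal.tsum_le_tsum fun i => (setLIntegral_le_lintegral _ _).trans_eq ?_
  have hfhat : fhat (bandlimited MeasurableSet.univ hfin) 0 = 1 := by
    simpa [hvol, Filter.EventuallyEq] using fhat_bandlimited MeasurableSet.univ hfin
  rw [translationSystem, inner_translation_eq_integral_crossSpectrum hball, hvol, integral_dirac,
    lintegral_dirac]
  simp [crossSpectrum, hfhat, Matrix.det_isEmpty, ENNReal.ofReal_pow]

/-- An exhaustion of `ℝᵈ ∖ {0}` by open shells. For `d = 0` every shell is the whole space, which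
`ℝᵈ ∖ {0}` would miss although the origin is not a null set. -/
def shell (d n : ℕ) : Set (Rd d) :=
  {ξ | d = 0 ∨ (1 / ((n : ℝ) + 1) < ‖ξ‖ ∧ ‖ξ‖ < n + 1)}

theorem isOpen_shell (d n : ℕ) : IsOpen (shell d n) :=
  isOpen_const.union ((isOpen_lt continuous_const continuous_norm).inter
    (isOpen_lt continuous_norm continuous_const))

theorem shell_mono (d : ℕ) : Monotone (shell d) := by
  intro m n hmn ξ hξ
  have hcast : (m : ℝ) + 1 ≤ n + 1 := by gcongr
  exact hξ.imp_right fun h =>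
    ⟨(one_div_le_one_div_of_le (by positivity) hcast).trans_lt h.1, h.2.trans_le hcast⟩

theorem isBounded_shell (d n : ℕ) : Bornology.IsBounded (shell d n) := by
  refine isBounded_iff_forall_norm_le.2 ⟨n + 1, fun ξ hξ => ?_⟩
  rcases hξ with rfl | h
  · rw [Subsingleton.elim ξ 0, norm_zero]
    positivity
  · exact h.2.le

theorem ae_exists_mem_shell (d : ℕ) : ∀ᵐ ξ : Rd d, ∃ n, ξ ∈ shell d n := by
  rcases eq_or_ne d 0 with hd | hd
  · exact .of_forall fun ξ => ⟨0, .inl hd⟩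
  · have : Nonempty (Fin d) := Fin.pos_iff_nonempty.1 (Nat.pos_of_ne_zero hd)
    filter_upwards [Measure.ae_ne volume (0 : Rd d)] with ξ hξ
    obtain ⟨m, hm⟩ := exists_nat_one_div_lt (norm_pos_iff.2 hξ)
    obtain ⟨n, hn⟩ := exists_nat_gt ‖ξ‖
    have hmax : ((max m n : ℕ) : ℝ) = max (m : ℝ) n := Nat.cast_max _ _
    refine ⟨max m n, .inr ⟨lt_of_le_of_lt ?_ hm, ?_⟩⟩
    · rw [hmax]
      gcongr
      exact le_max_left _ _
    · rw [hmax]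
      linarith [le_max_right (m : ℝ) n]

theorem ae_exists_mem_overlap_shell (α : Rd d) :
    ∀ᵐ ξ : Rd d, ∃ n, ξ ∈ overlap (shell d n) α := by
  filter_upwards [ae_exists_mem_shell d, (measurePreserving_add_right volume
    α).quasiMeasurePreserving.ae (ae_exists_mem_shell d)] with ξ ⟨m, hm⟩ ⟨n, hn⟩
  exact ⟨max m n, shell_mono d (le_max_left _ _) hm, shell_mono d (le_max_right _ _) hn⟩

theorem LocallyIntegrableSystem.on_shell {C : P → Matrix (Fin d) (Fin d) ℝ} {g : P → L2Rd d}
    (hgL : LocallyIntegrableSystem C g) (hg : IsBessel (translationSystem C g)) (n : ℕ) :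
    LocallyIntegrableSystemOn C g (shell d n) := by
  rcases eq_or_ne d 0 with rfl | hd
  · exact hg.locallyIntegrableSystemOn_of_dimension_zero _
  · exact hgL.on_of_isOpen (isOpen_shell d n) (isBounded_shell d n) Nat.one_div_pos_of_nat
      fun ξ hξ => (hξ.resolve_left hd).1.le

theorem eq_zero_of_forall_inner_shell_eq_zero {u : L2Rd d}
    (hu : ∀ n, ∀ v ∈ spectralBall (shell d n), inner ℂ v u = 0) : u = 0 := by
  have hvanish (n : ℕ) : ∀ᵐ ξ, ξ ∈ shell d n → fhat u ξ = 0 := by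
    have hm := (isOpen_shell d n).measurableSet
    have hfin : volume (shell d n) ≠ ∞ := (isBounded_shell d n).measure_lt_top.ne
    have : IsFiniteMeasure (volume.restrict (shell d n)) := isFiniteMeasure_restrict.2 hfin
    rw [← ae_restrict_iff' hm]
    have hint := ((memLp_fhat u).restrict (shell d n)).integrable one_le_two
    refine hint.ae_eq_zero_of_forall_setIntegral_eq_zero fun s hs _ => ?_
    rw [Measure.restrict_restrict hs, ← inner_bandlimited (hs.inter hm)
      (measure_ne_top_of_subset Set.inter_subset_right hfin)]
    exact hu n _ (bandlimited_mem_spectralBall _ _ Set.inter_subset_right)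
  refine eq_zero_of_fhat_ae_eq_zero ?_
  filter_upwards [ae_all_iff.2 hvanish, ae_exists_mem_shell d] with ξ hξ ⟨n, hn⟩
  exact hξ n hn

theorem continuousLinearMap_eq_zero_of_forall_inner_shell_eq_zero {T : L2Rd d →L[ℂ] L2Rd d}
    (hT : ∀ n, ∀ f ∈ spectralBall (shell d n), ∀ v ∈ spectralBall (shell d n),
      inner ℂ v (T f) = 0) : T = 0 := by
  have hmono {m n : ℕ} (hmn : m ≤ n) : spectralBall (shell d m) ⊆ spectralBall (shell d n) :=
    spectralBall_mono (shell_mono d hmn)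
  have himage (m : ℕ) (f : L2Rd d) (hf : f ∈ spectralBall (shell d m)) : T f = 0 :=
    eq_zero_of_forall_inner_shell_eq_zero fun n v hv =>
      hT (max m n) f (hmono (le_max_left m n) hf) v (hmono (le_max_right m n) hv)
  have hadjoint : ContinuousLinearMap.adjoint T = 0 := by
    ext1 u
    refine eq_zero_of_forall_inner_shell_eq_zero fun n f hf => ?_
    rw [ContinuousLinearMap.adjoint_inner_right, himage n f hf, inner_zero_left]
  exact (map_eq_zero_iff _ ContinuousLinearMap.adjoint.injective).1 hadjoint

end LocalIntegrability

/-! ### Symbols -/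

section Symbol

variable {d : ℕ} {P : Type*} {C : P → Matrix (Fin d) (Fin d) ℝ} {g h : P → L2Rd d}
  {A : Set (Rd d)} {f v : L2Rd d}

/-- The symbol at the frequency `α`: the sum over `P_α` of the terms
`|det C_p|⁻¹ conj(ĥ_p(ξ)) ĝ_p(ξ + α)`. -/
noncomputable def symbolAt (C : P → Matrix (Fin d) (Fin d) ℝ) (g h : P → L2Rd d) (α ξ : Rd d) :
    ℂ :=
  ∑' p : indexSet C α, symbolTerm C g h α p ξ

@[simp]
theorem indexSet_zero (C : P → Matrix (Fin d) (Fin d) ℝ) : indexSet C 0 = Set.univ :=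
  Set.eq_univ_of_forall fun p => ⟨0, by ext i; simp [Matrix.mulVec, dotProduct]⟩

theorem symbolAt_zero (C : P → Matrix (Fin d) (Fin d) ℝ) (g h : P → L2Rd d) :
    symbolAt C g h 0 = symbol C g h := by
  ext ξ
  rw [symbolAt, indexSet_zero, tsum_univ fun p => symbolTerm C g h 0 p ξ]
  simp [symbol, symbolTerm]

theorem dualPoint_eq_iff (hC : ∀ p, IsUnit (C p).det) (i : P × (Fin d → ℤ)) (α : Rd d) :
    dualPoint C i = α ↔ ((C i.1)ᵀ *ᵥ fun j => α j) = fun j => (i.2 j : ℝ) := by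
  rw [dualPoint, ← dualEquiv_intCast (hC i.1), ← dualEquiv_symm_apply (hC i.1),
    ContinuousLinearEquiv.symm_apply_eq, eq_comm]

theorem mem_dualLattices_of_mem_indexSet (hC : ∀ p, IsUnit (C p).det) {α : Rd d} {p : P}
    (hp : p ∈ indexSet C α) : α ∈ dualLattices C := by
  obtain ⟨z, hz⟩ := hp
  exact Set.mem_iUnion.2 ⟨p, z, (dualPoint_eq_iff hC (p, z) α).2 hz⟩

theorem symbolAt_eq_zero_of_notMem_dualLattices (hC : ∀ p, IsUnit (C p).det) {α : Rd d}
    (hα : α ∉ dualLattices C) (g h : P → L2Rd d) : symbolAt C g h α = 0 := by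
  have : IsEmpty (indexSet C α) := ⟨fun p => hα (mem_dualLattices_of_mem_indexSet hC p.2)⟩
  ext ξ
  exact tsum_empty

theorem forall_symbolAt_ae_eq_zero_iff (hC : ∀ p, IsUnit (C p).det) :
    (∀ α, symbolAt C g h α =ᵐ[volume] 0) ↔
      (∀ α ∈ dualLattices C \ {0}, symbolAt C g h α =ᵐ[volume] 0) ∧
        symbol C g h =ᵐ[volume] 0 := by
  refine ⟨fun hs => ⟨fun α _ => hs α, symbolAt_zero C g h ▸ hs 0⟩, fun ⟨hα, hs⟩ α => ?_⟩
  rcases eq_or_ne α 0 with rfl | hα0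
  · rwa [symbolAt_zero]
  · by_cases hΛ : α ∈ dualLattices C
    · exact hα α ⟨hΛ, hα0⟩
    · rw [symbolAt_eq_zero_of_notMem_dualLattices hC hΛ]

/-- The pairs `(p, k)` with `C_p' k = α` correspond to the elements of `P_α`. -/
noncomputable def fiberEquiv (hC : ∀ p, IsUnit (C p).det) (α : Rd d) :
    {i // dualPoint C i = α} ≃ indexSet C α :=
  Equiv.ofBijective (fun i => ⟨i.1.1, i.1.2, (dualPoint_eq_iff hC i.1 α).1 i.2⟩) (by
    constructor
    · rintro ⟨⟨p, k⟩, hk⟩ ⟨⟨q, l⟩, hl⟩ hpq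
      obtain rfl : p = q := congrArg Subtype.val hpq
      have hkl := ((dualPoint_eq_iff hC (p, k) α).1 hk).symm.trans
        ((dualPoint_eq_iff hC (p, l) α).1 hl)
      obtain rfl : k = l := funext fun j => Int.cast_injective (congrFun hkl j)
      rfl
    · rintro ⟨p, z, hz⟩
      exact ⟨⟨(p, z), (dualPoint_eq_iff hC _ α).2 hz⟩, rfl⟩)

theorem aestronglyMeasurable_symbolTerm (C : P → Matrix (Fin d) (Fin d) ℝ) (g h : P → L2Rd d)
    (α : Rd d) (p : P) : AEStronglyMeasurable (symbolTerm C g h α p) :=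
  (aestronglyMeasurable_const.mul (aestronglyMeasurable_fhat (h p)).star).mul
    ((aestronglyMeasurable_fhat (g p)).comp_measurePreserving
      (measurePreserving_add_right volume α))

theorem enorm_symbolTerm_le (C : P → Matrix (Fin d) (Fin d) ℝ) (g h : P → L2Rd d)
    (α : Rd d) (p : P) (ξ : Rd d) :
    ‖symbolTerm C g h α p ξ‖ₑ ≤ ENNReal.ofReal (|(C p).det|⁻¹) * ‖fhat (h p) ξ‖ₑ ^ 2 +
      ENNReal.ofReal (|(C p).det|⁻¹) * ‖fhat (g p) (ξ + α)‖ₑ ^ 2 := by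
  have hdet : 0 ≤ |(C p).det|⁻¹ := by positivity
  simp only [← ofReal_norm, ← ENNReal.ofReal_pow (norm_nonneg _), ← ENNReal.ofReal_mul hdet]
  rw [← ENNReal.ofReal_add (by positivity) (by positivity)]
  refine ENNReal.ofReal_le_ofReal ?_
  rw [symbolTerm, norm_mul, norm_mul, Complex.norm_real, Real.norm_of_nonneg hdet,
    RCLike.norm_conj, mul_assoc, ← mul_add]
  gcongr
  nlinarith [sq_nonneg (‖fhat (h p) ξ‖ - ‖fhat (g p) (ξ + α)‖),
    sq_nonneg (‖fhat (h p) ξ‖), sq_nonneg (‖fhat (g p) (ξ + α)‖)]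

theorem setLIntegral_overlap_comp_add (A : Set (Rd d)) (α : Rd d) (φ : Rd d → ℝ≥0∞) :
    ∫⁻ ξ in overlap A α, φ (ξ + α) = ∫⁻ ξ in overlap A (-α), φ ξ := by
  have hpreimage : (· + α) ⁻¹' overlap A (-α) = overlap A α := by
    ext ξ
    simp [overlap, and_comm]
  rw [← hpreimage, (measurePreserving_add_right volume α).setLIntegral_comp_preimage_emb
    (measurableEmbedding_addRight α)]

theorem dualPoint_neg (C : P → Matrix (Fin d) (Fin d) ℝ) (p : P) (k : Fin d → ℤ) :
    dualPoint C (p, -k) = -dualPoint C (p, k) := by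
  ext j
  simp [dualPoint, latticePoint, Matrix.mulVec, dotProduct]

theorem tsum_lintegral_symbolTerm_ne_top (hg : LocallyIntegrableSystemOn C g A)
    (hh : LocallyIntegrableSystemOn C h A) :
    ∑' i : P × (Fin d → ℤ), ∫⁻ ξ in overlap A (dualPoint C i),
      ‖symbolTerm C g h (dualPoint C i) i.1 ξ‖ₑ ≠ ∞ := by
  let w (f : L2Rd d) (p : P) (ξ : Rd d) : ℝ≥0∞ := ENNReal.ofReal (|(C p).det|⁻¹) * ‖fhat f ξ‖ₑ ^ 2
  have hw (f : L2Rd d) (p : P) : AEMeasurable (w f p) :=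
    ((aestronglyMeasurable_fhat f).enorm.pow_const 2).const_mul _
  have hle (i : P × (Fin d → ℤ)) : ∫⁻ ξ in overlap A (dualPoint C i),
      ‖symbolTerm C g h (dualPoint C i) i.1 ξ‖ₑ ≤
      (∫⁻ ξ in overlap A (dualPoint C i), w (h i.1) i.1 ξ) +
        ∫⁻ ξ in overlap A (-dualPoint C i), w (g i.1) i.1 ξ := by
    rw [← setLIntegral_overlap_comp_add, ← lintegral_add_left' (hw _ _).restrict]
    exact lintegral_mono fun ξ => enorm_symbolTerm_le C g h _ i.1 ξ
  have hreflect : ∑' i : P × (Fin d → ℤ), ∫⁻ ξ in overlap A (-dualPoint C i), w (g i.1) i.1 ξ =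
      ∑' i : P × (Fin d → ℤ), ∫⁻ ξ in overlap A (dualPoint C i), w (g i.1) i.1 ξ := by
    rw [← (Equiv.prodCongr (Equiv.refl P) (Equiv.neg (Fin d → ℤ))).tsum_eq]
    refine tsum_congr fun ⟨p, k⟩ => ?_
    change ∫⁻ ξ in overlap A (-dualPoint C (p, -k)), w (g p) p ξ = _
    rw [dualPoint_neg, neg_neg]
  refine ne_top_of_le_ne_top ?_ (ENNReal.tsum_le_tsum hle)
  rw [ENNReal.tsum_add, hreflect]
  exact ENNReal.add_ne_top.2 ⟨hh, hg⟩

theorem tsum_lintegral_indexSet_ne_top (hC : ∀ p, IsUnit (C p).det)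
    (hg : LocallyIntegrableSystemOn C g A) (hh : LocallyIntegrableSystemOn C h A) (α : Rd d) :
    ∑' p : indexSet C α, ∫⁻ ξ in overlap A α, ‖symbolTerm C g h α p ξ‖ₑ ≠ ∞ := by
  refine ne_top_of_le_ne_top (tsum_lintegral_symbolTerm_ne_top hg hh) ?_
  rw [← (fiberEquiv hC α).tsum_eq]
  refine (tsum_congr fun i => ?_).trans_le
    (ENNReal.tsum_comp_le_tsum_of_injective Subtype.val_injective _)
  rw [i.2]
  rfl

theorem ae_summable_symbolTerm [Countable P] (hC : ∀ p, IsUnit (C p).det)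
    (hg : ∀ n, LocallyIntegrableSystemOn C g (shell d n))
    (hh : ∀ n, LocallyIntegrableSystemOn C h (shell d n)) (α : Rd d) :
    ∀ᵐ ξ, Summable fun p : indexSet C α => symbolTerm C g h α p ξ := by
  have hshell (n : ℕ) : ∀ᵐ ξ, ξ ∈ overlap (shell d n) α →
      Summable fun p : indexSet C α => ‖symbolTerm C g h α p ξ‖ := by
    have hm := (isOpen_shell d n).measurableSet
    rw [← ae_restrict_iff' (measurableSet_overlap hm α)]
    refine summable_norm_of_tsum_eLpNorm_ne_top le_rfl
      (fun p => (aestronglyMeasurable_symbolTerm C g h α p).restrict) ?_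
    simp only [eLpNorm_one_eq_lintegral_enorm]
    exact tsum_lintegral_indexSet_ne_top hC (hg n) (hh n) α
  filter_upwards [ae_all_iff.2 hshell, ae_exists_mem_overlap_shell α] with ξ hξ ⟨n, hn⟩
  exact (hξ n hn).of_norm

theorem ae_summable_symbolTerm_zero [Countable P] (hC : ∀ p, IsUnit (C p).det)
    (hg : ∀ n, LocallyIntegrableSystemOn C g (shell d n))
    (hh : ∀ n, LocallyIntegrableSystemOn C h (shell d n)) :
    ∀ᵐ ξ, Summable fun p => symbolTerm C g h 0 p ξ := by
  filter_upwards [ae_summable_symbolTerm hC hg hh 0] with ξ hξ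
  rw [indexSet_zero] at hξ
  exact (Equiv.Set.univ P).symm.summable_iff.2 hξ

theorem integrableOn_symbolAt [Countable P] (hC : ∀ p, IsUnit (C p).det)
    (hg : LocallyIntegrableSystemOn C g A) (hh : LocallyIntegrableSystemOn C h A) (α : Rd d) :
    IntegrableOn (symbolAt C g h α) (overlap A α) := by
  have hm (p : indexSet C α) := (aestronglyMeasurable_symbolTerm C g h α p).restrict
    (s := overlap A α)
  refine ⟨(AEMeasurable.tsum fun p => (hm p).aemeasurable).aestronglyMeasurable, ?_⟩
  refine (lintegral_mono fun ξ => enorm_tsum_le_tsum_enorm).trans_lt ?_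
  rw [lintegral_tsum fun p => (hm p).enorm]
  exact (tsum_lintegral_indexSet_ne_top hC hg hh α).lt_top

theorem symbolAt_ae_eq_zero [Countable P] (hC : ∀ p, IsUnit (C p).det)
    (hg : ∀ n, LocallyIntegrableSystemOn C g (shell d n))
    (hh : ∀ n, LocallyIntegrableSystemOn C h (shell d n)) {α : Rd d}
    (hpairing : ∀ n, ∀ f ∈ spectralBall (shell d n), ∀ v ∈ spectralBall (shell d n),
      spectralPairing (symbolAt C g h α) α f v = 0) :
    symbolAt C g h α =ᵐ[volume] 0 := by
  have hshell (n : ℕ) : ∀ᵐ ξ, ξ ∈ overlap (shell d n) α → symbolAt C g h α ξ = 0 := by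
    have hm := (isOpen_shell d n).measurableSet
    exact ae_eq_zero_on_overlap_of_spectralPairing_eq_zero hm
      (isBounded_shell d n).measure_lt_top.ne
      (integrableOn_symbolAt hC (hg n) (hh n) α) (hpairing n)
  filter_upwards [ae_all_iff.2 hshell, ae_exists_mem_overlap_shell α] with ξ hξ ⟨n, hn⟩
  exact hξ n hn

end Symbol

/-! ### The Fourier series of the mixed dual Gramian -/

section MixedGramian

variable {d : ℕ} {P : Type*} {C : P → Matrix (Fin d) (Fin d) ℝ} {g h : P → L2Rd d}
  {A : Set (Rd d)} {f v : L2Rd d}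

/-- The contribution of the index `(p, k)` to the Fourier coefficient at the frequency `C_p' k` of
the function `x ↦ ⟨Θ T_x f, T_x v⟩`. -/
noncomputable def coefficient (C : P → Matrix (Fin d) (Fin d) ℝ) (g h : P → L2Rd d)
    (f v : L2Rd d) (i : P × (Fin d → ℤ)) : ℂ :=
  spectralPairing (symbolTerm C g h (dualPoint C i) i.1) (dualPoint C i) f v

theorem summable_norm_coefficient (hg : LocallyIntegrableSystemOn C g A)
    (hh : LocallyIntegrableSystemOn C h A) (hf : f ∈ spectralBall A) (hv : v ∈ spectralBall A) :
    Summable fun i => ‖coefficient C g h f v i‖ :=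
  tsum_enorm_ne_top_iff_summable_norm.1 <|
    ne_top_of_le_ne_top (tsum_lintegral_symbolTerm_ne_top hg hh) <|
      ENNReal.tsum_le_tsum fun _ => enorm_spectralPairing_le _ _ hf hv

theorem tsum_fiber_coefficient [Countable P]
    (hC : ∀ p, IsUnit (C p).det)
    (hg : LocallyIntegrableSystemOn C g A) (hh : LocallyIntegrableSystemOn C h A)
    (hf : f ∈ spectralBall A) (hv : v ∈ spectralBall A) (α : Rd d) :
    ∑' i : {i // dualPoint C i = α}, coefficient C g h f v i =
      spectralPairing (symbolAt C g h α) α f v := by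
  rw [show symbolAt C g h α = fun ξ => ∑' p : indexSet C α, symbolTerm C g h α p ξ from rfl,
    ← tsum_spectralPairing (fun p : indexSet C α => aestronglyMeasurable_symbolTerm C g h α p)
      (tsum_lintegral_indexSet_ne_top hC hg hh α) hf hv, ← (fiberEquiv hC α).tsum_eq]
  refine tsum_congr fun i => ?_
  rw [coefficient, i.2]
  rfl

theorem hasSum_inner_Theta (hg : IsBessel (translationSystem C g))
    (hh : IsBessel (translationSystem C h)) (f v : L2Rd d) :
    HasSum (fun i => inner ℂ (translationSystem C h i) f * inner ℂ v (translationSystem C g i))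
      (inner ℂ v (Theta hg hh f)) := by
  refine ((hasSum_mixedGramian hh hg f).mapL (innerSL ℂ v)).congr_fun fun i => ?_
  simp

theorem hasSum_inner_mul_inner_translationSystem (hA : Bornology.IsBounded A) {p : P}
    (hC : IsUnit (C p).det) (hf : f ∈ spectralBall A) (hv : v ∈ spectralBall A) :
    HasSum (fun k => inner ℂ (translationSystem C h (p, k)) f *
        inner ℂ v (translationSystem C g (p, k)))
      (∑' k, coefficient C g h f v (p, k)) := by
  convert hasSum_lattice_samples hC (memLp_crossSpectrum hf (h p)) (memLp_crossSpectrum hv (g p))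
    (isBounded_support_crossSpectrum hA f (h p)) (isBounded_support_crossSpectrum hA v (g p))
    using 1
  · ext k
    rw [← inner_translation_eq_integral_crossSpectrum hf,
      ← inner_translation_eq_integral_crossSpectrum hv, inner_conj_symm]
    rfl
  · refine tsum_congr fun k => ?_
    rw [coefficient, spectralPairing, ← integral_const_mul]
    refine integral_congr_ae ?_
    filter_upwards [crossSpectrum_ae_eq hf (h p), (measurePreserving_add_right volume
      (dualPoint C (p, k))).quasiMeasurePreserving.ae_eq_comp (crossSpectrum_ae_eq hv (g p))]
      with ξ hfξ hvξ
    simp only [Function.comp, dualPoint] at hvξ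
    rw [hfξ, hvξ, map_mul, Complex.conj_conj, symbolTerm, dualPoint]
    ring

theorem inner_Theta_eq_tsum_coefficient [Countable P]
    (hC : ∀ p, IsUnit (C p).det)
    (hgB : IsBessel (translationSystem C g)) (hhB : IsBessel (translationSystem C h))
    (hg : LocallyIntegrableSystemOn C g A) (hh : LocallyIntegrableSystemOn C h A)
    (hA : Bornology.IsBounded A) (hf : f ∈ spectralBall A) (hv : v ∈ spectralBall A) :
    inner ℂ v (Theta hgB hhB f) = ∑' i, coefficient C g h f v i := by
  rw [(summable_norm_coefficient hg hh hf hv).of_norm.tsum_prod]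
  exact ((hasSum_inner_Theta hgB hhB f v).prod_fiberwise fun p =>
    hasSum_inner_mul_inner_translationSystem hA (hC p) hf hv).tsum_eq.symm

theorem inner_Theta_translation_eq_tsum [Countable P]
    (hC : ∀ p, IsUnit (C p).det)
    (hgB : IsBessel (translationSystem C g)) (hhB : IsBessel (translationSystem C h))
    (hg : LocallyIntegrableSystemOn C g A) (hh : LocallyIntegrableSystemOn C h A)
    (hA : Bornology.IsBounded A) (hf : f ∈ spectralBall A) (hv : v ∈ spectralBall A) (x : Rd d) :
    inner ℂ (translation x v) (Theta hgB hhB (translation x f)) =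
      ∑' i, coefficient C g h f v i * character x (dualPoint C i) := by
  rw [inner_Theta_eq_tsum_coefficient hC hgB hhB hg hh hA (translation_mem_spectralBall hf x)
    (translation_mem_spectralBall hv x)]
  simp only [coefficient, spectralPairing_translation]

theorem inner_translation_of_mem_translationCommutant {T : L2Rd d →L[ℂ] L2Rd d}
    (hT : T ∈ translationCommutant d) (x : Rd d) (f v : L2Rd d) :
    inner ℂ (translation x v) (T (translation x f)) = inner ℂ v (T f) := by
  have hcomm : translation x * T = T * translation x :=
    Set.mem_centralizer_iff.1 hT _ ⟨x, rfl⟩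
  have hTf : T (translation x f) = translation x (T f) := (DFunLike.congr_fun hcomm f).symm
  rw [hTf]
  exact LinearIsometry.inner_map_map _ _ _

theorem spectralPairing_symbolAt_of_mem_translationCommutant [Countable P]
    (hC : ∀ p, IsUnit (C p).det)
    (hgB : IsBessel (translationSystem C g)) (hhB : IsBessel (translationSystem C h))
    (hg : LocallyIntegrableSystemOn C g A) (hh : LocallyIntegrableSystemOn C h A)
    (hA : Bornology.IsBounded A) (hΘ : Theta hgB hhB ∈ translationCommutant d)
    (hf : f ∈ spectralBall A) (hv : v ∈ spectralBall A) (α : Rd d) :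
    spectralPairing (symbolAt C g h α) α f v =
      if α = 0 then inner ℂ v (Theta hgB hhB f) else 0 := by
  rw [← tsum_fiber_coefficient hC hg hh hf hv]
  refine tsum_fiber_eq_of_tsum_character_eq_const (summable_norm_coefficient hg hh hf hv)
    (dualPoint C) (fun x => ?_) α
  rw [← inner_Theta_translation_eq_tsum hC hgB hhB hg hh hA hf hv,
    inner_translation_of_mem_translationCommutant hΘ]

theorem symbolAt_ae_eq_zero_of_mem_translationCommutant [Countable P]
    (hC : ∀ p, IsUnit (C p).det)
    (hgB : IsBessel (translationSystem C g)) (hhB : IsBessel (translationSystem C h))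
    (hg : ∀ n, LocallyIntegrableSystemOn C g (shell d n))
    (hh : ∀ n, LocallyIntegrableSystemOn C h (shell d n))
    (hΘ : Theta hgB hhB ∈ translationCommutant d) {α : Rd d} (hα : α ≠ 0) :
    symbolAt C g h α =ᵐ[volume] 0 :=
  symbolAt_ae_eq_zero hC hg hh fun n f hf v hv => by
    rw [spectralPairing_symbolAt_of_mem_translationCommutant hC hgB hhB (hg n) (hh n)
      (isBounded_shell d n) hΘ hf hv, if_neg hα]

theorem Theta_eq_zero_iff_symbolAt_ae_eq_zero [Countable P]
    (hC : ∀ p, IsUnit (C p).det)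
    (hgB : IsBessel (translationSystem C g)) (hhB : IsBessel (translationSystem C h))
    (hg : ∀ n, LocallyIntegrableSystemOn C g (shell d n))
    (hh : ∀ n, LocallyIntegrableSystemOn C h (shell d n)) :
    Theta hgB hhB = 0 ↔ ∀ α, symbolAt C g h α =ᵐ[volume] 0 := by
  constructor
  · intro hΘ α
    have hcomm : Theta hgB hhB ∈ translationCommutant d := hΘ ▸ Set.zero_mem_centralizer
    refine symbolAt_ae_eq_zero hC hg hh fun n f hf v hv => ?_
    rw [spectralPairing_symbolAt_of_mem_translationCommutant hC hgB hhB (hg n) (hh n)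
      (isBounded_shell d n) hcomm hf hv, hΘ]
    simp
  · intro hsymbol
    refine continuousLinearMap_eq_zero_of_forall_inner_shell_eq_zero fun n f hf v hv => ?_
    have hfiber (α : Rd d) : ∑' i : {i // dualPoint C i = α}, coefficient C g h f v i = 0 := by
      rw [tsum_fiber_coefficient hC (hg n) (hh n) hf hv,
        spectralPairing_congr_ae (hsymbol α)]
      simp [spectralPairing]
    rw [inner_Theta_eq_tsum_coefficient hC hgB hhB (hg n) (hh n) (isBounded_shell d n) hf hv,
      ← ((summable_norm_coefficient (hg n) (hh n) hf hv).of_norm.hasSum.tsum_fiberwise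
        (dualPoint C)).tsum_eq]
    exact (tsum_congr hfiber).trans tsum_zero

end MixedGramian

theorem corollaryC {d : ℕ} {P : Type*} [Countable P]
    (C : P → Matrix (Fin d) (Fin d) ℝ) (hC : ∀ p, IsUnit (C p).det)
    (g h : P → L2Rd d)
    (hg : IsBessel (translationSystem C g)) (hh : IsBessel (translationSystem C h))
    (hgL : LocallyIntegrableSystem C g) (hhL : LocallyIntegrableSystem C h) :
    -- the series below converge (absolutely) almost everywhere
    (∀ᵐ ξ : Rd d, Summable fun p : P => symbolTerm C g h 0 p ξ) ∧
    (∀ α ∈ dualLattices C, ∀ᵐ ξ : Rd d,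
      Summable fun p : indexSet C α => symbolTerm C g h α p ξ) ∧
    -- the first characterization
    (Theta hg hh = 0 ↔
      Theta hg hh ∈ translationCommutant d ∧ ∀ᵐ ξ : Rd d, symbol C g h ξ = 0) ∧
    -- the second characterization
    (Theta hg hh = 0 ↔
      (∀ α ∈ dualLattices C \ {0}, ∀ᵐ ξ : Rd d,
        ∑' p : indexSet C α, symbolTerm C g h α p ξ = 0) ∧
      ∀ᵐ ξ : Rd d, symbol C g h ξ = 0) := by
  have hgS := hgL.on_shell hg
  have hhS := hhL.on_shell hh
  have hsymbol : Theta hg hh = 0 ↔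
      (∀ α ∈ dualLattices C \ {0}, symbolAt C g h α =ᵐ[volume] 0) ∧ symbol C g h =ᵐ[volume] 0 :=
    (Theta_eq_zero_iff_symbolAt_ae_eq_zero hC hg hh hgS hhS).trans
      (forall_symbolAt_ae_eq_zero_iff hC)
  have hcommutant (hΘ : Theta hg hh ∈ translationCommutant d) :
      ∀ α ∈ dualLattices C \ {0}, symbolAt C g h α =ᵐ[volume] 0 := fun α hα =>
    symbolAt_ae_eq_zero_of_mem_translationCommutant hC hg hh hgS hhS hΘ hα.2
  refine ⟨ae_summable_symbolTerm_zero hC hgS hhS,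
    fun α _ => ae_summable_symbolTerm hC hgS hhS α, ⟨fun hΘ => ?_, fun ⟨hΘ, hs⟩ => ?_⟩, hsymbol⟩
  · exact ⟨hΘ ▸ Set.zero_mem_centralizer, (hsymbol.1 hΘ).2⟩
  · exact hsymbol.2 ⟨hcommutant hΘ, hs⟩
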